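/- Let $\mathbb{F}_q$ be a fixed finite field with $q\equiv 1 \pmod 4$ elements. For a nonzero $f\in\mathbb{F}_q[x]$ put $|f|=q^{\deg f}$, and let $$\mathcal{H}_{2g+1,q}=\{D\in\mathbb{F}_q[x] : D \text{ monic, square-free, } \deg D=2g+1\}.$$ For $D\in\mathcal{H}_{2g+1,q}$ let $C_D$ be the smooth projective curve of genus $g$ with affine equation $y^2=D(x)$, let $N_n(C_D)$ be its number of points over $\mathbb{F}_{q^n}$, and let $P_{C_D}(u)$ be the numerator of its zeta function, i.e. the polynomial of degree at most $2g$ with $$\exp\Big(\sum_{n\ge 1}N_n(C_D)\frac{u^n}{n}\Big)=\frac{P_{C_D}(u)}{(1-u)(1-qu)}.$$ Let $$P(s)=\prod_{\substack{P \text{ monic}\\ \text{irreducible}}}\Big(1-\frac{1}{(|P|+1)|P|^{s}}\Big),$$ the product being over the monic irreducible polynomials of $\mathbb{F}_q[x]$; it converges at $s=1$. Then $$\frac{1}{\#\mathcal{H}_{2g+1,q}}\sum_{D\in\mathcal{H}_{2g+1,q}}P_{C_D}(q^{-1/2})\;\sim\;\frac12 P(1)\log_q|D|=\frac12 P(1)(2g+1)\qquad\text{as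 } g\to\infty,$$ where $|D|=q^{2g+1}$ for every $D\in\mathcal{H}_{2g+1,q}$. -/

import Mathlib

open Polynomial Filter Asymptotics

noncomputable section

namespace HyperellipticMoment

variable {F : Type*} [Field F] [Fintype F]

/-- The norm `|f| = q ^ deg f` of a nonzero polynomial over the finite field with `q` elements,
with `|0| = 0`. -/
def polyNorm (f : F[X]) : ℝ :=
  open scoped Classical in if f = 0 then 0 else (Fintype.card F : ℝ) ^ f.natDegree

/-- The monic irreducible polynomials ("primes") of `F[x]`. -/
abbrev MonicIrreducible (F : Type*) [Field F] : Type _ :=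
  {P : F[X] // P.Monic ∧ Irreducible P}

/-- The Euler factor `1 - 1 / ((|P| + 1) |P| ^ s)`. -/
def eulerFactor (s : ℝ) (P : MonicIrreducible F) : ℝ :=
  1 - 1 / ((polyNorm P.1 + 1) * polyNorm P.1 ^ s)

/-- The arithmetic factor `P(s)`, a product over all monic irreducible polynomials. -/
def arithFactor (F : Type*) [Field F] [Fintype F] (s : ℝ) : ℝ :=
  ∏' P : MonicIrreducible F, eulerFactor s P

theorem finite_monic_squarefree (F : Type*) [Field F] [Fintype F] (d : ℕ) :
    {D : F[X] | D.Monic ∧ D.natDegree = d ∧ Squarefree D}.Finite := by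
  have : Finite (degreeLT F (d + 1)) :=
    Finite.of_equiv _ (degreeLTEquiv F (d + 1)).toEquiv.symm
  refine (Set.toFinite (degreeLT F (d + 1) : Set F[X])).subset ?_
  rintro D ⟨hm, hd, -⟩
  rw [SetLike.mem_coe, mem_degreeLT, degree_eq_natDegree hm.ne_zero, hd]
  exact_mod_cast Nat.lt_succ_self d

/-- The set of monic square-free polynomials of degree `d` in `F[x]`. With `d = 2 * g + 1` this is
the hyperelliptic ensemble. -/
def ensemble (F : Type*) [Field F] [Fintype F] (d : ℕ) : Finset F[X] :=
  (finite_monic_squarefree F d).toFinset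

/-- The genus `g` of the hyperelliptic curve `y² = D(x)`: here `deg D` is `2g + 1` or `2g + 2`. -/
def genus (D : F[X]) : ℕ := (D.natDegree - 1) / 2

/-- The `K`-points of the smooth projective model `C_D` of the affine curve `y² = D(x)`. The model
is glued from the chart `y² = D(x)` and the chart `v² = u^(2g+2) D(1/u)` along `u = 1/x`,
`v = y / x^(g+1)`. Its points are those of the first chart together with the points of the second
chart having `u = 0`. -/
abbrev CurvePoints (D : F[X]) (K : Type*) [Field K] [Algebra F K] : Type _ :=
  {p : K × K // p.2 ^ 2 = aeval p.1 D} ⊕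
    {v : K // v ^ 2 = aeval (0 : K) (reflect (2 * genus D + 2) D)}

/-- `N_n(C_D)`: the number of points of `C_D` over the extension of `F` of degree `n`. -/
def pointCount (D : F[X]) (n : ℕ) [NeZero n] : ℕ :=
  haveI : Fact (ringChar F).Prime := ⟨CharP.char_is_prime F (ringChar F)⟩
  Nat.card (CurvePoints D (FiniteField.Extension F (ringChar F) n))

/-- The formal power series `∑_{n ≥ 1} N_n(C_D) uⁿ / n`. -/
def logZeta (D : F[X]) : PowerSeries ℚ :=
  PowerSeries.mk fun
    | 0 => 0
    | n + 1 => (pointCount D (n + 1) : ℚ) / ((n + 1 : ℕ) : ℚ)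

/-- The zeta function `Z_{C_D}(u) = exp (∑_{n ≥ 1} N_n(C_D) uⁿ / n)` as a formal power series. -/
def zetaSeries (D : F[X]) : PowerSeries ℚ :=
  (PowerSeries.exp ℚ).subst (logZeta D)

/-- The series `(1 - u) (1 - q u) Z_{C_D}(u)`. -/
def numeratorSeries (D : F[X]) : PowerSeries ℚ :=
  (1 - PowerSeries.X) * (1 - PowerSeries.C (Fintype.card F : ℚ) * PowerSeries.X) * zetaSeries D

/-- The numerator `P_{C_D}(u)` of the zeta function, a polynomial of degree at most `2g`. That
the series `(1 - u) (1 - q u) Z_{C_D}(u)` has no further terms is not built into the definition. -/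
def zetaNumerator (D : F[X]) : ℚ[X] :=
  PowerSeries.trunc (2 * genus D + 1) (numeratorSeries D)

/-- The average of `P_{C_D}(q^{-1/2})` over the monic square-free `D` of degree `2g + 1`. -/
def centralAverage (F : Type*) [Field F] [Fintype F] (g : ℕ) : ℝ :=
  ((ensemble F (2 * g + 1)).card : ℝ)⁻¹ *
    ∑ D ∈ ensemble F (2 * g + 1),
      aeval ((Fintype.card F : ℝ) ^ (-(1 / 2) : ℝ)) (zetaNumerator D)

end HyperellipticMoment

end

/-!
The numerator `P_{C_D}` of the zeta function is the `L`-function `∑ χ_D(f) u ^ deg f` of the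
quadratic symbol `χ_D`, the sum being over monic `f`. The symbol is defined here as the quadratic
character of `F` at the resultant of `D` and `f` (`symbol`). Multiplicativity and periodicity come
from the resultant, quadratic reciprocity is its symmetry, with no sign because `-1` is a square
when `q ≡ 1 mod 4` (`symbol_comm`), and at a prime modulus it is the Legendre symbol because the
resultant is a norm (`quadraticChar_aeval`).

*The zeta function.* Grouping the points over the extension of degree `k` by their minimal
polynomials gives `N_k = 1 + q ^ k + ∑ deg(P) χ_D(P) ^ (k / deg P)`, a sum over primes with
`deg P ∣ k` (`pointCount_eq`). The same sums are the coefficients of `u L'(u) / L(u)`, by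
`deg f = ∑ deg P` over the prime powers dividing `f` (`mul_lCoeff`). So `(1 - u) (1 - q u) Z(u)` and
`L(u)` have the same logarithmic derivative (`numeratorSeries_eq`). The coefficients `A_n` of
`L` vanish for `n ≥ deg D`, where they are sums of `χ_D` over complete residue systems.

*The functional equation* `q ^ g A_n = q ^ n A_{2g - n}` follows from the Gauss sum expansion
`χ_D(h) τ ^ deg D = ∑ χ_D(f) ψ(res(f h / D))` for square-free `D`, where `τ` is the quadratic Gauss
sum of `F` and the residue is taken at infinity (`symbolGaussSum_of_squarefree`). It is
multiplicative in `D`, and for a prime modulus the sum is one of `ψ` over a quadratic form which has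
an isotropic subspace of half the dimension (`sum_addChar_residueAt_sq`). This evaluates the Gauss
sum together with its sign, which is what makes the sign of the functional equation `+1`.

*The mean value.* By the functional equation the central value is a sum over `n ≤ g`, taken twice
up to the term `n = g`. Exchange the average over `D` with the sum over monic `f` of degree `n`.
If `f` is not a square, sieve for square-free `D`: the small square divisors contribute complete
character sums modulo `f`, which vanish, and the trivial bound for the others makes the total over
all `n ≤ g` bounded (`abs_sum_ensemble_symbol_le`, `abs_centralAverage_sub_le`). If `f = l ^ 2`,
the symbol detects `gcd(D, l) = 1`. The proportion of coprime pairs `(l, D)` tends to `P(1)` as both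
degrees grow (`tendsto_coprimePairs`), by inclusion and exclusion over sets of common primes, each
prime having density `1 / (|P| + 1)` among square-free polynomials, and dominated convergence. There
are about `g / 2` even degrees `n ≤ g`, so the average is `g P(1) + o(g)`, with `P(1) ≠ 0`.
-/

noncomputable section

namespace HyperellipticMoment

variable {F : Type*} [Field F] [Fintype F]

/-! ### Monic polynomials and residues -/

theorem finite_degreeLT (F : Type*) [Field F] [Fintype F] (n : ℕ) :
    (degreeLT F n : Set F[X]).Finite :=
  have : Finite (degreeLT F n) := Finite.of_equiv _ (degreeLTEquiv F n).toEquiv.symm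
  Set.toFinite _

/-- The polynomials of degree less than `n`: the standard residues modulo a monic polynomial of
degree `n`. -/
def residues (F : Type*) [Field F] [Fintype F] (n : ℕ) : Finset F[X] :=
  (finite_degreeLT F n).toFinset

@[simp] theorem mem_residues {n : ℕ} {f : F[X]} : f ∈ residues F n ↔ f.degree < n := by
  simp [residues, mem_degreeLT]

theorem card_residues (n : ℕ) : (residues F n).card = Fintype.card F ^ n := by
  rw [residues, ← Set.ncard_eq_toFinset_card _ (finite_degreeLT F n), ← Nat.card_coe_set_eq]
  have h : Nat.card (degreeLT F n) = Nat.card (Fin n → F) :=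
    Nat.card_congr (degreeLTEquiv F n).toEquiv
  rw [Nat.card_fun, Nat.card_fin, Nat.card_eq_fintype_card (α := F)] at h
  exact h

theorem residues_zero : residues F 0 = {0} := by
  ext f
  simp

theorem finite_monics (F : Type*) [Field F] [Fintype F] (n : ℕ) :
    {f : F[X] | f.Monic ∧ f.natDegree = n}.Finite := by
  refine (finite_degreeLT F (n + 1)).subset ?_
  rintro D ⟨hm, hd⟩
  rw [SetLike.mem_coe, mem_degreeLT, degree_eq_natDegree hm.ne_zero, hd]
  exact_mod_cast Nat.lt_succ_self n

/-- The monic polynomials of degree `n`. -/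
def monics (F : Type*) [Field F] [Fintype F] (n : ℕ) : Finset F[X] :=
  (finite_monics F n).toFinset

@[simp] theorem mem_monics {n : ℕ} {f : F[X]} : f ∈ monics F n ↔ f.Monic ∧ f.natDegree = n := by
  simp [monics]

@[simp] theorem mem_ensemble {n : ℕ} {f : F[X]} :
    f ∈ ensemble F n ↔ f.Monic ∧ f.natDegree = n ∧ Squarefree f := by
  simp [ensemble]

theorem ensemble_subset_monics (n : ℕ) : ensemble F n ⊆ monics F n := fun f hf => by
  rw [mem_ensemble] at hf
  exact mem_monics.2 ⟨hf.1, hf.2.1⟩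

theorem sum_monics {M : Type*} [AddCommMonoid M] (n : ℕ) (φ : F[X] → M) :
    ∑ f ∈ monics F n, φ f = ∑ r ∈ residues F n, φ (X ^ n + r) := by
  refine (Finset.sum_bij (fun r _ => X ^ n + r) ?_ ?_ ?_ ?_).symm
  · intro r hr
    rw [mem_residues] at hr
    exact mem_monics.2 ⟨monic_X_pow_add hr, by
      rw [natDegree_add_eq_left_of_degree_lt (by simpa using hr), natDegree_X_pow]⟩
  · intro a _ b _ h
    exact add_left_cancel h
  · intro f hf
    obtain ⟨hm, hd⟩ := mem_monics.1 hf
    refine ⟨f - X ^ n, ?_, by ring⟩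
    rw [mem_residues]
    have h1 : f.degree = ((X : F[X]) ^ n).degree := by
      rw [degree_X_pow, degree_eq_natDegree hm.ne_zero, hd]
    have := degree_sub_lt_left h1 hm.ne_zero (by rw [hm.leadingCoeff, (monic_X_pow n).leadingCoeff])
    rwa [degree_eq_natDegree hm.ne_zero, hd] at this
  · intros; rfl

theorem card_monics (n : ℕ) : (monics F n).card = Fintype.card F ^ n := by
  rw [Finset.card_eq_sum_ones, sum_monics, ← Finset.card_eq_sum_ones, card_residues]

theorem monics_zero : monics F 0 = {1} := by
  ext f
  rw [mem_monics, Finset.mem_singleton]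
  constructor
  · rintro ⟨h1, h2⟩
    exact eq_one_of_monic_natDegree_zero h1 h2
  · rintro rfl
    simp

/-- A function of period `D` runs through a full set of residues `q ^ (n - deg D)` times as its
argument runs through the monic polynomials of degree `n ≥ deg D`. -/
theorem sum_monics_periodic {M : Type*} [AddCommMonoid M] {D : F[X]} (hD : D.Monic) {n : ℕ}
    (hn : D.natDegree ≤ n) (φ : F[X] → M) (hφ : ∀ f h, φ (f + D * h) = φ f) :
    ∑ f ∈ monics F n, φ f =
      Fintype.card F ^ (n - D.natDegree) • ∑ r ∈ residues F D.natDegree, φ r := by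
  have h1 : ∑ f ∈ monics F n, φ f =
      ∑ p ∈ monics F (n - D.natDegree) ×ˢ residues F D.natDegree, φ (p.2 + D * p.1) := by
    refine (Finset.sum_bij' (fun p _ => p.2 + D * p.1) (fun f _ => (f /ₘ D, f %ₘ D))
      ?_ ?_ ?_ ?_ ?_).symm
    · rintro ⟨h, r⟩ hp
      rw [Finset.mem_product, mem_monics, mem_residues] at hp
      obtain ⟨⟨hm, hd⟩, hr⟩ := hp
      have hdeg : (D * h).natDegree = n := by rw [hD.natDegree_mul hm, hd]; omega
      have hlt : r.degree < (D * h).degree := by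
        refine lt_of_lt_of_le hr ?_
        rw [degree_eq_natDegree (hD.mul hm).ne_zero, hdeg]
        exact_mod_cast hn
      rw [mem_monics]
      exact ⟨(hD.mul hm).add_of_right hlt, by
        rw [natDegree_add_eq_right_of_degree_lt hlt, hdeg]⟩
    · intro f hf
      obtain ⟨hm, hd⟩ := mem_monics.1 hf
      rw [Finset.mem_product, mem_monics, mem_residues]
      refine ⟨⟨?_, ?_⟩, ?_⟩
      · have hle : D.degree ≤ f.degree := by
          rw [degree_eq_natDegree hm.ne_zero, degree_eq_natDegree hD.ne_zero, hd]
          exact_mod_cast hn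
        rw [Monic, leadingCoeff_divByMonic_of_monic hD hle, hm.leadingCoeff]
      · rw [natDegree_divByMonic _ hD, hd]
      · rw [← degree_eq_natDegree hD.ne_zero]
        exact degree_modByMonic_lt _ hD
    · rintro ⟨h, r⟩ hp
      rw [Finset.mem_product, mem_residues] at hp
      have hlt : r.degree < D.degree := by
        rw [degree_eq_natDegree hD.ne_zero]; exact hp.2
      have := div_modByMonic_unique h r hD ⟨rfl, hlt⟩
      exact Prod.ext this.1 this.2
    · intro f _
      exact modByMonic_add_div f D
    · intros; rfl
  rw [h1, Finset.sum_product]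
  simp only [hφ]
  rw [Finset.sum_const, card_monics]

/-- The multiples of a monic `A` among the monic polynomials of degree `n`. -/
theorem sum_monics_dvd {M : Type*} [AddCommMonoid M] {A : F[X]} (hA : A.Monic) [DecidablePred
    (fun f : F[X] => A ∣ f)] (n : ℕ) (φ : F[X] → M) :
    ∑ f ∈ monics F n with A ∣ f, φ f =
      if A.natDegree ≤ n then ∑ f ∈ monics F (n - A.natDegree), φ (A * f) else 0 := by
  split_ifs with h
  · refine (Finset.sum_bij (fun f _ => A * f) ?_ ?_ ?_ ?_).symm
    · intro f hf
      obtain ⟨hm, hd⟩ := mem_monics.1 hf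
      rw [Finset.mem_filter, mem_monics]
      exact ⟨⟨hA.mul hm, by rw [hA.natDegree_mul hm, hd]; omega⟩, dvd_mul_right _ _⟩
    · intro a _ b _ hab
      exact mul_left_cancel₀ hA.ne_zero hab
    · intro f hf
      rw [Finset.mem_filter, mem_monics] at hf
      obtain ⟨⟨hm, hd⟩, g, rfl⟩ := hf
      have hg := hA.of_mul_monic_left hm
      refine ⟨g, ?_, rfl⟩
      rw [mem_monics]
      rw [hA.natDegree_mul hg] at hd
      exact ⟨hg, by omega⟩
    · intros; rfl
  · apply Finset.sum_eq_zero
    intro f hf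
    rw [Finset.mem_filter, mem_monics] at hf
    obtain ⟨⟨hm, hd⟩, hdvd⟩ := hf
    exact absurd (hd ▸ natDegree_le_of_dvd hdvd hm.ne_zero) h

theorem card_monics_dvd {A : F[X]} (hA : A.Monic) [DecidablePred (fun f : F[X] => A ∣ f)]
    (n : ℕ) : {f ∈ monics F n | A ∣ f}.card =
      if A.natDegree ≤ n then Fintype.card F ^ (n - A.natDegree) else 0 := by
  rw [Finset.card_eq_sum_ones, sum_monics_dvd hA]
  simp [card_monics]

/-- The Chinese remainder theorem, in the form that needs no reduction of the degree. -/
theorem sum_residues_mul {M : Type*} [AddCommMonoid M] {A B : F[X]} (hA : A.Monic) (hB : B.Monic)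
    (hAB : IsCoprime A B) (φ : F[X] → M) :
    ∑ f ∈ residues F (A.natDegree + B.natDegree), φ f =
      ∑ f ∈ residues F A.natDegree, ∑ g ∈ residues F B.natDegree, φ (f * B + g * A) := by
  classical
  rw [← Finset.sum_product']
  have hmaps : ∀ p ∈ residues F A.natDegree ×ˢ residues F B.natDegree,
      p.1 * B + p.2 * A ∈ residues F (A.natDegree + B.natDegree) := by
    rintro ⟨f, g⟩ hp
    rw [Finset.mem_product, mem_residues, mem_residues] at hp
    rw [mem_residues]
    refine lt_of_le_of_lt (degree_add_le _ _) (max_lt ?_ ?_)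
    · rw [degree_mul, degree_eq_natDegree hB.ne_zero, Nat.cast_add]
      exact WithBot.add_lt_add_right (by simp) hp.1
    · rw [degree_mul, degree_eq_natDegree hA.ne_zero, Nat.cast_add, add_comm]
      exact WithBot.add_lt_add_left (by simp) hp.2
  have hinj : Set.InjOn (fun p : F[X] × F[X] => p.1 * B + p.2 * A)
      (residues F A.natDegree ×ˢ residues F B.natDegree : Finset (F[X] × F[X])) := by
    rintro ⟨f, g⟩ hp ⟨f', g'⟩ hp' h
    simp only [Finset.coe_product, Set.mem_prod, Finset.mem_coe, mem_residues] at hp hp' h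
    have h2 : (f - f') * B = (g' - g) * A := by linear_combination h
    have hf : f - f' = 0 := by
      refine eq_zero_of_dvd_of_degree_lt (p := A)
        (hAB.dvd_of_dvd_mul_right (Dvd.intro_left _ h2.symm)) ?_
      rw [degree_eq_natDegree hA.ne_zero]
      exact lt_of_le_of_lt (degree_sub_le _ _) (max_lt hp.1 hp'.1)
    rw [hf, zero_mul, zero_eq_mul, or_iff_left hA.ne_zero] at h2
    rw [sub_eq_zero] at h2 hf
    rw [hf, h2]
  have himg : (residues F A.natDegree ×ˢ residues F B.natDegree).image
      (fun p : F[X] × F[X] => p.1 * B + p.2 * A) = residues F (A.natDegree + B.natDegree) := by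
    refine Finset.eq_of_subset_of_card_le (Finset.image_subset_iff.2 hmaps) ?_
    rw [Finset.card_image_of_injOn hinj, Finset.card_product, card_residues, card_residues,
      card_residues, pow_add]
  rw [← himg, Finset.sum_image hinj]

/-! ### The quadratic symbol -/

open scoped Classical in
/-- The quadratic residue symbol of `f` modulo a monic `D`, as the quadratic character of `F` at the
resultant of `D` and `f`. The resultant is the norm of `f` from `F[x] / (D)` to `F`, which makes
this the Jacobi symbol; for monic `D` and `f` the symbol with exchanged arguments differs from it
only by the sign `(-1) ^ (deg D * deg f)` inside the quadratic character. -/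
def symbol (D f : F[X]) : ℤ := quadraticChar F (resultant D f)

omit [Fintype F] in
theorem resultant_eq_of_monic {D f : F[X]} (hD : D.Monic) {n : ℕ} (hn : f.natDegree ≤ n) :
    resultant D f D.natDegree n = resultant D f := by
  obtain ⟨k, rfl⟩ := Nat.exists_eq_add_of_le hn
  rw [resultant_add_right_deg _ _ _ _ k le_rfl, coeff_natDegree, hD.leadingCoeff, one_pow, one_mul]

theorem symbol_mul_left {A B : F[X]} (hA : A.Monic) (hB : B.Monic) (f : F[X]) :
    symbol (A * B) f = symbol A f * symbol B f := by
  rw [symbol, hA.natDegree_mul hB, resultant_mul_left _ _ _ _ le_rfl, map_mul, symbol, symbol]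

theorem symbol_mul_right {D : F[X]} (hD : D.Monic) (f g : F[X]) :
    symbol D (f * g) = symbol D f * symbol D g := by
  rw [symbol, ← resultant_eq_of_monic hD (natDegree_mul_le (p := f) (q := g)),
    resultant_mul_right _ _ _ _ le_rfl, map_mul, symbol, symbol]

@[simp] theorem symbol_one_left (f : F[X]) : symbol 1 f = 1 := by
  simp [symbol]

theorem symbol_one_right (D : F[X]) : symbol D 1 = 1 := by
  simp [symbol]

theorem symbol_add_mul {D : F[X]} (hD : D.Monic) (f h : F[X]) :
    symbol D (f + D * h) = symbol D f := by
  set n := max f.natDegree (h.natDegree + D.natDegree) with hn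
  have h1 : (f + D * h).natDegree ≤ n := by
    refine (natDegree_add_le _ _).trans (max_le_max le_rfl ?_)
    rw [add_comm h.natDegree]
    exact natDegree_mul_le
  rw [symbol, symbol, ← resultant_eq_of_monic hD h1,
    ← resultant_eq_of_monic hD (le_max_left f.natDegree (h.natDegree + D.natDegree)), ← hn,
    resultant_add_mul_right _ _ _ _ _ (le_max_right _ _) le_rfl]

theorem symbol_modByMonic {D : F[X]} (hD : D.Monic) (f : F[X]) :
    symbol D (f %ₘ D) = symbol D f := by
  conv_rhs => rw [← modByMonic_add_div f D]
  rw [symbol_add_mul hD]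

theorem symbol_pow_right {D : F[X]} (hD : D.Monic) (f : F[X]) (k : ℕ) :
    symbol D (f ^ k) = symbol D f ^ k := by
  induction k with
  | zero => rw [pow_zero, pow_zero, symbol_one_right]
  | succ k ih => rw [pow_succ, pow_succ, symbol_mul_right hD, ih]

theorem symbol_eq_zero_iff {D f : F[X]} (hD : D.Monic) :
    symbol D f = 0 ↔ ¬ IsCoprime D f := by
  classical
  rw [symbol, quadraticChar_eq_zero_iff, resultant_eq_zero_iff]
  simp [hD.ne_zero]

theorem symbol_sq {D f : F[X]} (hD : D.Monic) (h : IsCoprime D f) : symbol D f ^ 2 = 1 := by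
  classical
  refine quadraticChar_sq_one fun h0 => ?_
  exact (symbol_eq_zero_iff hD).1 (by rw [symbol, h0, quadraticChar_zero]) h

open scoped Classical in
theorem symbol_sq_right {D : F[X]} (hD : D.Monic) (f : F[X]) :
    symbol D (f ^ 2) = if IsCoprime D f then 1 else 0 := by
  rw [symbol_pow_right hD]
  split_ifs with h
  · exact symbol_sq hD h
  · rw [(symbol_eq_zero_iff hD).2 h, zero_pow two_ne_zero]

theorem abs_symbol_le_one (D f : F[X]) : |symbol D f| ≤ 1 := by
  classical
  rw [symbol]
  rcases eq_or_ne (resultant D f) 0 with h | h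
  · rw [h, quadraticChar_zero, abs_zero]; exact zero_le_one
  · rcases quadraticChar_dichotomy h with h | h <;> rw [h] <;> simp

open scoped Classical in
theorem symbol_C (D : F[X]) (c : F) :
    symbol D (C c) = quadraticChar F c ^ D.natDegree := by
  rw [symbol, natDegree_C, resultant_C_right, pow_zero, one_mul, map_pow]

theorem ringChar_ne_two (hq : Fintype.card F ≡ 1 [MOD 4]) : ringChar F ≠ 2 := by
  intro h
  have := FiniteField.even_card_iff_char_two.1 h
  have h2 : Fintype.card F % 4 = 1 := hq
  omega

theorem quadraticChar_neg_one_eq_one [DecidableEq F] (hq : Fintype.card F ≡ 1 [MOD 4]) :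
    quadraticChar F (-1) = 1 := by
  rw [quadraticChar_one_iff_isSquare (neg_ne_zero.2 one_ne_zero), FiniteField.isSquare_neg_one_iff]
  have h2 : Fintype.card F % 4 = 1 := hq
  omega

/-- Quadratic reciprocity: exchanging the arguments of a resultant changes at most its sign, and
`-1` is a square when `q ≡ 1 mod 4`. -/
theorem symbol_comm (hq : Fintype.card F ≡ 1 [MOD 4]) (D f : F[X]) :
    symbol D f = symbol f D := by
  classical
  rw [symbol, resultant_comm, map_mul, map_pow, symbol]
  convert one_mul _
  convert one_pow _
  exact quadraticChar_neg_one_eq_one hq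

/-- A symbol to an odd modulus sums to zero over each dilation-invariant set: some constant has
symbol `-1`. -/
theorem sum_symbol_eq_zero_of_odd (hq : ringChar F ≠ 2) {D : F[X]} (hD : D.Monic)
    (hodd : Odd D.natDegree) (n : ℕ) : ∑ f ∈ residues F n, symbol D f = 0 := by
  classical
  obtain ⟨c, hc⟩ := quadraticChar_exists_neg_one' hq
  have h1 : ∑ f ∈ residues F n, symbol D f = ∑ f ∈ residues F n, symbol D (C (c : F) * f) := by
    refine (Finset.sum_bij' (fun f _ => C (c : F) * f) (fun f _ => C ((c⁻¹ : Fˣ) : F) * f)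
      ?_ ?_ ?_ ?_ ?_).symm
    · intro f hf
      rw [mem_residues] at hf ⊢
      rwa [degree_C_mul c.ne_zero]
    · intro f hf
      rw [mem_residues] at hf ⊢
      rwa [degree_C_mul c⁻¹.ne_zero]
    · intro f _
      rw [← mul_assoc, ← C_mul, Units.inv_mul, C_1, one_mul]
    · intro f _
      rw [← mul_assoc, ← C_mul, Units.mul_inv, C_1, one_mul]
    · intros; rfl
  simp only [symbol_mul_right hD, symbol_C, hc, hodd.neg_one_pow, neg_one_mul,
    Finset.sum_neg_distrib] at h1
  linarith

/-- A symbol sums to zero over all residues as soon as it takes the value `-1`. -/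
theorem sum_symbol_eq_zero_of_neg_one {D g : F[X]} (hD : D.Monic) (hg : symbol D g = -1) :
    ∑ f ∈ residues F D.natDegree, symbol D f = 0 := by
  have hcop : IsCoprime D g := by
    by_contra h
    rw [(symbol_eq_zero_iff hD).2 h] at hg
    norm_num at hg
  have hmod : ∀ f : F[X], f %ₘ D ∈ residues F D.natDegree := fun f => by
    rw [mem_residues, ← degree_eq_natDegree hD.ne_zero]
    exact degree_modByMonic_lt _ hD
  have hinj : Set.InjOn (fun f => (g * f) %ₘ D) (residues F D.natDegree : Finset F[X]) := by
    intro a ha b hb hab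
    rw [Finset.mem_coe, mem_residues, ← degree_eq_natDegree hD.ne_zero] at ha hb
    have h1 : D ∣ g * (a - b) := by
      rw [← modByMonic_eq_zero_iff_dvd hD, mul_sub, sub_modByMonic, sub_eq_zero]
      exact hab
    have := eq_zero_of_dvd_of_degree_lt (hcop.dvd_of_dvd_mul_left h1)
      (lt_of_le_of_lt (degree_sub_le _ _) (max_lt ha hb))
    exact sub_eq_zero.1 this
  classical
  have himg : (residues F D.natDegree).image (fun f => (g * f) %ₘ D) = residues F D.natDegree :=
    Finset.eq_of_subset_of_card_le (Finset.image_subset_iff.2 fun f _ => hmod _)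
      (by rw [Finset.card_image_of_injOn hinj])
  have h1 : ∑ f ∈ residues F D.natDegree, symbol D f =
      ∑ f ∈ residues F D.natDegree, symbol D (g * f) := by
    conv_lhs => rw [← himg, Finset.sum_image hinj]
    simp only [symbol_modByMonic hD]
  simp only [symbol_mul_right hD, hg, neg_one_mul, Finset.sum_neg_distrib] at h1
  linarith

/-! ### Symbols and quadratic characters of extension fields -/

open scoped IntermediateField in
/-- The norm of a value `f(x)`, as a power of the resultant of `f` and the minimal polynomial. -/
theorem norm_aeval_eq_resultant_pow {K : Type*} [Field K] [Finite K] [Algebra F K] (x : K)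
    (f : F[X]) :
    Algebra.norm F (aeval x f) =
      resultant (minpoly F x) f ^ Module.finrank F⟮x⟯ K := by
  have hfin : FiniteDimensional F K := Module.Finite.of_finite
  have hx : IsIntegral F x := IsIntegral.of_finite F x
  have hgen : aeval x f = algebraMap F⟮x⟯ K (aeval (IntermediateField.AdjoinSimple.gen F x) f) := by
    rw [← aeval_algebraMap_apply, IntermediateField.AdjoinSimple.algebraMap_gen]
  rw [hgen, ← Algebra.norm_norm (S := F⟮x⟯), Algebra.norm_algebraMap, map_pow]
  congr 1
  set E := AlgebraicClosure F
  apply (algebraMap F E).injective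
  rw [Algebra.norm_eq_prod_embeddings]
  have hsep : (minpoly F x).Separable := Algebra.IsSeparable.isSeparable F x
  have hmon := minpoly.monic hx
  have hnodup : ((minpoly F x).aroots E).Nodup := nodup_roots hsep.map
  rw [← resultant_map_map, ← natDegree_map (algebraMap F E),
    resultant_eq_prod_eval _ _ _ natDegree_map_le (IsAlgClosed.splits _),
    (hmon.map _).leadingCoeff, one_pow, one_mul]
  classical
  rw [← Equiv.prod_comp (IntermediateField.algHomAdjoinIntegralEquiv F hx).symm]
  have h2 : ∀ y : {y // y ∈ (minpoly F x).aroots E},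
      (IntermediateField.algHomAdjoinIntegralEquiv F hx).symm y
        (aeval (IntermediateField.AdjoinSimple.gen F x) f) = (f.map (algebraMap F E)).eval y.1 := by
    intro y
    rw [← aeval_algHom_apply, IntermediateField.algHomAdjoinIntegralEquiv_symm_apply_gen,
      eval_map_algebraMap]
  rw [Fintype.prod_congr _ _ h2]
  have h3 : ∏ y ∈ ((minpoly F x).aroots E).toFinset, (f.map (algebraMap F E)).eval y =
      (((minpoly F x).aroots E).map (f.map (algebraMap F E)).eval).prod := by
    rw [Finset.prod, Multiset.toFinset_val, hnodup.dedup]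
  exact (Finset.prod_subtype ((minpoly F x).aroots E).toFinset (fun y => Multiset.mem_toFinset)
    (fun y => (f.map (algebraMap F E)).eval y)).symm.trans h3

/-- The quadratic character of an extension is the norm followed by that of the base field. -/
theorem quadraticChar_eq_quadraticChar_norm {K : Type*} [Field K] [Fintype K] [Algebra F K]
    [DecidableEq F] [DecidableEq K] (hF : ringChar F ≠ 2) (y : K) :
    quadraticChar K y = quadraticChar F (Algebra.norm F y) := by
  have hfin : FiniteDimensional F K := Module.Finite.of_finite
  have hchar : ringChar K = ringChar F := (Algebra.ringChar_eq F K).symm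
  have hK : ringChar K ≠ 2 := hchar ▸ hF
  have key : ((quadraticChar K y : ℤ) : K) = ((quadraticChar F (Algebra.norm F y) : ℤ) : K) := by
    have h1 := congrArg (algebraMap F K)
      (quadraticChar_eq_pow_of_char_ne_two' hF (Algebra.norm F y))
    rw [map_intCast, map_pow, FiniteField.algebraMap_norm_eq_pow, ← pow_mul] at h1
    rw [h1, quadraticChar_eq_pow_of_char_ne_two' hK]
    congr 1
    rw [Nat.card_eq_fintype_card, Nat.card_eq_fintype_card]
    have hq := FiniteField.odd_card_of_char_ne_two hF
    have hQ := FiniteField.odd_card_of_char_ne_two hK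
    obtain ⟨c, hc⟩ : (Fintype.card F - 1) ∣ (Fintype.card K - 1) := by
      rw [Module.card_eq_pow_finrank (K := F) (V := K)]
      simpa using Nat.sub_dvd_pow_sub_pow (Fintype.card F) 1 (Module.finrank F K)
    have h2 : 1 < Fintype.card F := Fintype.one_lt_card
    obtain ⟨m, hm⟩ : ∃ m, Fintype.card F = 2 * m + 1 := ⟨Fintype.card F / 2, by omega⟩
    have hm0 : 0 < m := by omega
    have h3 : Fintype.card K = 2 * (m * c) + 1 := by
      have h4 : 1 < Fintype.card K := Fintype.one_lt_card
      rw [hm, Nat.add_sub_cancel] at hc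
      rw [mul_assoc] at hc
      omega
    rw [h3, hm, Nat.add_sub_cancel, Nat.add_sub_cancel, show (2 * (m * c) + 1) / 2 = m * c by omega,
      show (2 * m + 1) / 2 = m by omega, show 2 * (m * c) = 2 * m * c by ring,
      Nat.mul_div_cancel_left _ (by omega), mul_comm]
  rcases eq_or_ne y 0 with rfl | hy
  · rw [Algebra.norm_zero, quadraticChar_zero, quadraticChar_zero]
  have hN : Algebra.norm F y ≠ 0 := by rwa [Ne, Algebra.norm_eq_zero_iff]
  have hne : (-1 : K) ≠ 1 := Ring.neg_one_ne_one_of_char_ne_two hK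
  rcases quadraticChar_dichotomy hy with h | h <;>
    rcases quadraticChar_dichotomy hN with h' | h' <;> rw [h, h'] at key ⊢ <;>
    simp only [Int.cast_one, Int.cast_neg] at key
  · exact absurd key.symm hne
  · exact absurd key hne

open scoped IntermediateField in
theorem quadraticChar_aeval {K : Type*} [Field K] [Fintype K] [Algebra F K]
    [DecidableEq K] (hF : ringChar F ≠ 2) (x : K) (f : F[X]) :
    quadraticChar K (aeval x f) = symbol (minpoly F x) f ^ Module.finrank F⟮x⟯ K := by
  classical
  rw [quadraticChar_eq_quadraticChar_norm (F := F) hF, norm_aeval_eq_resultant_pow, map_pow, symbol]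

theorem finite_adjoinRoot {P : F[X]} (hP : P.Monic) : Finite (AdjoinRoot P) :=
  have : Module.Finite F (AdjoinRoot P) := hP.finite_adjoinRoot
  Module.finite_of_finite F

/-- At a prime modulus the symbol is the Legendre symbol. -/
theorem symbol_eq_quadraticChar_mk (hF : ringChar F ≠ 2) {P : F[X]} (hP : P.Monic)
    [Fact (Irreducible P)] [Fintype (AdjoinRoot P)] [DecidableEq (AdjoinRoot P)] (f : F[X]) :
    symbol P f = quadraticChar (AdjoinRoot P) (AdjoinRoot.mk P f) := by
  have h := quadraticChar_aeval hF (AdjoinRoot.root P) f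
  rw [AdjoinRoot.aeval_eq] at h
  rw [h, AdjoinRoot.minpoly_root hP.ne_zero, hP.leadingCoeff, inv_one, C_1, mul_one]
  have htop : IntermediateField.adjoin F {AdjoinRoot.root P} = ⊤ :=
    IntermediateField.adjoin_root_eq_top P
  rw [htop, IntermediateField.finrank_top, pow_one]

theorem exists_symbol_eq_neg_one_of_irreducible (hF : ringChar F ≠ 2) {P : F[X]} (hP : P.Monic)
    (hirr : Irreducible P) : ∃ g, symbol P g = -1 := by
  classical
  have : Fact (Irreducible P) := ⟨hirr⟩
  have := finite_adjoinRoot hP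
  have := Fintype.ofFinite (AdjoinRoot P)
  have hK : ringChar (AdjoinRoot P) ≠ 2 := Algebra.ringChar_eq F (AdjoinRoot P) ▸ hF
  obtain ⟨a, ha⟩ := quadraticChar_exists_neg_one hK
  obtain ⟨g, rfl⟩ := AdjoinRoot.mk_surjective a
  exact ⟨g, by rw [symbol_eq_quadraticChar_mk hF hP, ha]⟩

/-! ### Residues of rational functions and additive characters -/

omit [Fintype F] in
theorem coeff_pred_natDegree_mul {A r : F[X]} (hA : A.Monic) {b : ℕ} (hr : r.degree < b) :
    (A * r).coeff (A.natDegree + b - 1) = r.coeff (b - 1) := by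
  cases b with
  | zero =>
    have : r = 0 := by simpa using hr
    simp [this]
  | succ b =>
    have h : r.natDegree ≤ b := by
      rcases eq_or_ne r 0 with rfl | h0
      · simp
      · rw [degree_eq_natDegree h0, Nat.cast_lt] at hr
        omega
    rw [← Nat.add_assoc, Nat.add_sub_cancel, Nat.add_sub_cancel,
      coeff_mul_add_eq_of_natDegree_le le_rfl h, coeff_natDegree, hA.leadingCoeff, one_mul]

/-- The coefficient of `1 / x` in the expansion of `f / D` at infinity, for monic `D`. -/
def residueAt (D f : F[X]) : F := (f %ₘ D).coeff (D.natDegree - 1)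

omit [Fintype F] in
theorem residueAt_add (D f g : F[X]) : residueAt D (f + g) = residueAt D f + residueAt D g := by
  simp [residueAt, add_modByMonic]

omit [Fintype F] in
theorem residueAt_C_mul (D f : F[X]) (c : F) : residueAt D (C c * f) = c * residueAt D f := by
  rw [← smul_eq_C_mul, residueAt, smul_modByMonic, coeff_smul, smul_eq_mul, residueAt]

omit [Fintype F] in
theorem residueAt_of_degree_lt {D f : F[X]} (hD : D.Monic) (hf : f.degree < D.natDegree) :
    residueAt D f = f.coeff (D.natDegree - 1) := by
  rw [residueAt, (modByMonic_eq_self_iff hD).2 (by rwa [degree_eq_natDegree hD.ne_zero])]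

omit [Fintype F] in
theorem residueAt_mul_cancel {A B : F[X]} (hA : A.Monic) (hB : B.Monic) (f : F[X]) :
    residueAt (A * B) (A * f) = residueAt B f := by
  have hlt : (f %ₘ B).degree < B.natDegree := by
    rw [← degree_eq_natDegree hB.ne_zero]
    exact degree_modByMonic_lt _ hB
  have h : (A * f) %ₘ (A * B) = A * (f %ₘ B) := by
    refine (div_modByMonic_unique (f /ₘ B) _ (hA.mul hB) ⟨?_, ?_⟩).2
    · conv_rhs => rw [← modByMonic_add_div f B]
      ring
    · rw [degree_mul, degree_mul, degree_eq_natDegree hB.ne_zero]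
      exact WithBot.add_lt_add_left (by simp [hA.ne_zero]) hlt
  rw [residueAt, h, hA.natDegree_mul hB, coeff_pred_natDegree_mul hA hlt, residueAt]

theorem sum_residues_add {M : Type*} [AddCommMonoid M] (m k : ℕ) (φ : F[X] → M) :
    ∑ f ∈ residues F (m + k), φ f =
      ∑ w ∈ residues F m, ∑ v ∈ residues F k, φ (w + X ^ m * v) := by
  rw [← Finset.sum_product']
  have hX : (X ^ m : F[X]).Monic := monic_X_pow m
  have hXd : (X ^ m : F[X]).degree = m := degree_X_pow m
  refine (Finset.sum_bij' (fun p _ => p.1 + X ^ m * p.2)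
    (fun f _ => (f %ₘ X ^ m, f /ₘ X ^ m)) ?_ ?_ ?_ ?_ ?_).symm
  · rintro ⟨w, v⟩ hp
    rw [Finset.mem_product, mem_residues, mem_residues] at hp
    rw [mem_residues]
    refine lt_of_le_of_lt (degree_add_le _ _) (max_lt ?_ ?_)
    · exact lt_of_lt_of_le hp.1 (by exact_mod_cast Nat.le_add_right m k)
    · rw [degree_mul, hXd, Nat.cast_add]
      exact WithBot.add_lt_add_left (by simp) hp.2
  · intro f hf
    rw [mem_residues] at hf
    rw [Finset.mem_product, mem_residues, mem_residues]
    refine ⟨hXd ▸ degree_modByMonic_lt _ hX, ?_⟩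
    rcases eq_or_ne (f /ₘ X ^ m) 0 with h0 | h0
    · rw [h0, degree_zero]; exact WithBot.bot_lt_coe _
    · have h1 : f /ₘ X ^ m ≠ 0 := h0
      rw [Ne, divByMonic_eq_zero_iff hX, not_lt, hXd] at h1
      have hf0 : f ≠ 0 := by
        rintro rfl
        simp at h1
      rw [degree_eq_natDegree hf0, Nat.cast_lt] at hf
      rw [degree_eq_natDegree hf0, Nat.cast_le] at h1
      rw [degree_eq_natDegree h0, natDegree_divByMonic _ hX, natDegree_X_pow, Nat.cast_lt]
      omega
  · rintro ⟨w, v⟩ hp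
    rw [Finset.mem_product, mem_residues, mem_residues] at hp
    have := div_modByMonic_unique v w hX ⟨rfl, hXd ▸ hp.1⟩
    exact Prod.ext this.2 this.1
  · intro f _
    exact modByMonic_add_div f _
  · intros; rfl

theorem sum_residues_one {M : Type*} [AddCommMonoid M] (φ : F[X] → M) :
    ∑ f ∈ residues F 1, φ f = ∑ c : F, φ (C c) := by
  refine (Finset.sum_bij (fun c _ => C c) ?_ ?_ ?_ ?_).symm
  · intro c _
    rw [mem_residues]
    exact degree_C_lt
  · intro a _ b _ h
    exact C_injective h
  · intro f hf
    rw [mem_residues, Nat.cast_one] at hf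
    exact ⟨f.coeff 0, Finset.mem_univ _, (eq_C_of_degree_le_zero (Order.le_of_lt_succ hf)).symm⟩
  · intros; rfl

/-- Orthogonality: under the pairing `(w, u) ↦ residueAt D (w * u)`, the annihilator of the
polynomials of degree `< m` among those of degree `< deg D` consists of those of degree
`< deg D - m`. -/
theorem sum_addChar_residueAt {ψ : AddChar F ℂ} (hψ : ψ ≠ 1) {D : F[X]} (hD : D.Monic) {m : ℕ}
    (hm : m ≤ D.natDegree) {u : F[X]} (hu : u.degree < D.natDegree)
    [Decidable (u.degree < ((D.natDegree - m : ℕ) : WithBot ℕ))] :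
    ∑ w ∈ residues F m, ψ (residueAt D (w * u)) =
      if u.degree < ((D.natDegree - m : ℕ) : WithBot ℕ) then (Fintype.card F : ℂ) ^ m else 0 := by
  split_ifs with h
  · have h1 : ∀ w ∈ residues F m, ψ (residueAt D (w * u)) = 1 := by
      intro w hw
      rw [mem_residues] at hw
      rcases eq_or_ne w 0 with rfl | hw0
      · simp [residueAt]
      rcases eq_or_ne u 0 with rfl | hu0
      · simp [residueAt]
      rw [degree_eq_natDegree hw0, Nat.cast_lt] at hw
      rw [degree_eq_natDegree hu0, Nat.cast_lt] at h
      have hlt : (w * u).natDegree < D.natDegree - 1 := by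
        rw [natDegree_mul hw0 hu0]; omega
      rw [residueAt_of_degree_lt hD, coeff_eq_zero_of_natDegree_lt hlt, AddChar.map_zero_eq_one]
      rw [degree_eq_natDegree (mul_ne_zero hw0 hu0), Nat.cast_lt]
      omega
    rw [Finset.sum_congr rfl h1, Finset.sum_const, card_residues]
    simp
  · have hu0 : u ≠ 0 := by
      rintro rfl
      exact h (by rw [degree_zero]; exact WithBot.bot_lt_coe _)
    rw [degree_eq_natDegree hu0, Nat.cast_lt] at hu h
    obtain ⟨c, hc⟩ : ∃ c, ψ c ≠ 1 := by
      by_contra! hall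
      exact hψ (by ext c; simpa using hall c)
    -- A monomial of complementary degree pairs with `u` to a prescribed value.
    set w₀ : F[X] := C (c / u.leadingCoeff) * X ^ (D.natDegree - 1 - u.natDegree) with hw₀
    have hlc : u.leadingCoeff ≠ 0 := leadingCoeff_ne_zero.2 hu0
    have hw₀m : w₀.degree < m := by
      refine lt_of_le_of_lt (degree_C_mul_X_pow_le _ _) ?_
      rw [Nat.cast_lt]
      omega
    have hval : residueAt D (w₀ * u) = c := by
      rw [hw₀, mul_assoc, residueAt_C_mul, residueAt_of_degree_lt hD, coeff_X_pow_mul']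
      · rw [if_pos (by omega), show D.natDegree - 1 - (D.natDegree - 1 - u.natDegree) = u.natDegree
          by omega, coeff_natDegree, div_mul_cancel₀ _ hlc]
      · rw [degree_mul, degree_X_pow, degree_eq_natDegree hu0, ← Nat.cast_add, Nat.cast_lt]
        omega
    have hshift : ∑ w ∈ residues F m, ψ (residueAt D (w * u)) =
        ψ c * ∑ w ∈ residues F m, ψ (residueAt D (w * u)) := by
      rw [Finset.mul_sum]
      refine Finset.sum_bij' (fun w _ => w - w₀) (fun w _ => w + w₀) ?_ ?_ ?_ ?_ ?_
      · intro w hw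
        rw [mem_residues] at hw ⊢
        exact lt_of_le_of_lt (degree_sub_le _ _) (max_lt hw hw₀m)
      · intro w hw
        rw [mem_residues] at hw ⊢
        exact lt_of_le_of_lt (degree_add_le _ _) (max_lt hw hw₀m)
      · intro w _; ring
      · intro w _; ring
      · intro w _
        rw [← AddChar.map_add_eq_mul]
        conv_rhs => rw [← hval, ← residueAt_add]
        congr 2
        ring
    have : (ψ c - 1) * ∑ w ∈ residues F m, ψ (residueAt D (w * u)) = 0 := by
      rw [sub_mul, one_mul, ← hshift, sub_self]
    exact (mul_eq_zero.1 this).resolve_left (sub_ne_zero.2 hc)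

/-! ### Quadratic Gauss sums -/

open scoped Classical in
/-- The quadratic character of a finite field with values in `ℂ`. -/
def quadraticCharC (K : Type*) [Field K] [Fintype K] : MulChar K ℂ :=
  (quadraticChar K).ringHomComp (Int.castRingHom ℂ)

open scoped Classical in
theorem quadraticCharC_apply (K : Type*) [Field K] [Fintype K] (a : K) :
    quadraticCharC K a = ((quadraticChar K a : ℤ) : ℂ) := rfl

theorem gaussSum_quadraticCharC {K : Type*} [Field K] [Fintype K] (hK : ringChar K ≠ 2)
    {ψ : AddChar K ℂ} (hψ : ψ ≠ 1) : gaussSum (quadraticCharC K) ψ = ∑ y : K, ψ (y ^ 2) := by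
  classical
  have h1 : ∑ y : K, ψ (y ^ 2) = ∑ a : K, ∑ y : K with y ^ 2 = a, ψ a := by
    rw [← Finset.sum_fiberwise' Finset.univ (fun y : K => y ^ 2) (fun a => ψ a)]
  have h2 : ∀ a : K, ({y : K | y ^ 2 = a} : Finset K).card = quadraticCharC K a + 1 := by
    intro a
    have := quadraticChar_card_sqrts hK a
    rw [quadraticCharC_apply]
    have h3 : ({y : K | y ^ 2 = a} : Finset K) = {x : K | x ^ 2 = a}.toFinset := by
      ext; simp
    rw [h3]
    have h4 := congrArg (Int.cast (R := ℂ)) this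
    push_cast at h4
    convert h4
  rw [h1, gaussSum]
  simp only [Finset.sum_const, nsmul_eq_mul, h2, add_mul, one_mul, Finset.sum_add_distrib]
  rw [(AddChar.sum_eq_zero_iff_ne_zero).2 hψ, add_zero]

theorem gaussSum_quadraticCharC_sq (hq : Fintype.card F ≡ 1 [MOD 4]) {ψ : AddChar F ℂ}
    (hψ : ψ ≠ 1) : gaussSum (quadraticCharC F) ψ ^ 2 = Fintype.card F := by
  classical
  have hF := ringChar_ne_two hq
  rw [gaussSum_sq ?_ ?_ (AddChar.IsPrimitive.of_ne_one hψ), quadraticCharC_apply,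
    quadraticChar_neg_one_eq_one hq, Int.cast_one, one_mul]
  · obtain ⟨a, ha⟩ := quadraticChar_exists_neg_one' hF
    intro h
    have h1 : quadraticCharC F a = 1 := by rw [h, MulChar.one_apply_coe]
    rw [quadraticCharC_apply, ha] at h1
    norm_num at h1
  · intro a
    rcases quadraticChar_isQuadratic F a with h | h | h <;> simp [quadraticCharC_apply, h]

/-- The quadratic Gauss sum of a polynomial modulus. The form `f ↦ residueAt D (f ^ 2)` splits off
hyperbolic planes until at most one square is left, because the polynomials of degree less than
half of `deg D` are isotropic. -/
theorem sum_addChar_residueAt_sq (hq : Fintype.card F ≡ 1 [MOD 4]) {ψ : AddChar F ℂ} (hψ : ψ ≠ 1)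
    {D : F[X]} (hD : D.Monic) :
    ∑ f ∈ residues F D.natDegree, ψ (residueAt D (f ^ 2)) =
      gaussSum (quadraticCharC F) ψ ^ D.natDegree := by
  classical
  have hF := ringChar_ne_two hq
  have h2 : (2 : F) ≠ 0 := Ring.two_ne_zero hF
  set N := D.natDegree with hN
  set m := N / 2 with hm
  obtain ⟨e, he, he2⟩ : ∃ e, N = m + (m + e) ∧ e < 2 := ⟨N - 2 * m, by omega, by omega⟩
  have hinner : ∀ v ∈ residues F (m + e),
      ∑ w ∈ residues F m, ψ (residueAt D ((w + X ^ m * v) ^ 2)) =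
        if v.degree < e then (Fintype.card F : ℂ) ^ m * ψ (residueAt D (X ^ (m + m) * v ^ 2))
        else 0 := by
    intro v hv
    rw [mem_residues] at hv
    have hterm : ∀ w ∈ residues F m, ψ (residueAt D ((w + X ^ m * v) ^ 2)) =
        ψ (residueAt D (w * (C 2 * (X ^ m * v)))) * ψ (residueAt D (X ^ (m + m) * v ^ 2)) := by
      intro w hw
      rw [mem_residues] at hw
      have hw2 : residueAt D (w ^ 2) = 0 := by
        rcases eq_or_ne w 0 with rfl | hw0
        · simp [residueAt]
        rw [degree_eq_natDegree hw0, Nat.cast_lt] at hw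
        rw [residueAt_of_degree_lt hD, coeff_eq_zero_of_natDegree_lt]
        · rw [natDegree_pow]; omega
        · rw [degree_eq_natDegree (pow_ne_zero 2 hw0), natDegree_pow, Nat.cast_lt]; omega
      have : (w + X ^ m * v) ^ 2 = w ^ 2 + (w * (C 2 * (X ^ m * v)) + X ^ (m + m) * v ^ 2) := by
        rw [map_ofNat]; ring
      rw [this, residueAt_add, residueAt_add, hw2, zero_add, AddChar.map_add_eq_mul]
    have hdeg : (C 2 * (X ^ m * v)).degree = m + v.degree := by
      rw [degree_C_mul h2, degree_mul, degree_X_pow]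
    rw [Finset.sum_congr rfl hterm, ← Finset.sum_mul, sum_addChar_residueAt hψ hD (by omega), hdeg]
    · have : ((m : WithBot ℕ) + v.degree < ((N - m : ℕ) : WithBot ℕ)) ↔ v.degree < e := by
        rw [show N - m = m + e by omega, Nat.cast_add]
        exact WithBot.add_lt_add_iff_left (by simp)
      simp only [← hN, this]
      split_ifs <;> simp
    · rw [hdeg, ← hN, he, Nat.cast_add]
      exact WithBot.add_lt_add_left (by simp) hv
  have hsplit : ∑ f ∈ residues F N, ψ (residueAt D (f ^ 2)) =
      ∑ v ∈ residues F (m + e), ∑ w ∈ residues F m, ψ (residueAt D ((w + X ^ m * v) ^ 2)) := by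
    rw [Finset.sum_comm]
    conv_lhs => rw [he]
    exact sum_residues_add m (m + e) (fun f => ψ (residueAt D (f ^ 2)))
  rw [hsplit, Finset.sum_congr rfl hinner, ← Finset.sum_filter]
  have hfilter : {v ∈ residues F (m + e) | v.degree < (e : WithBot ℕ)} = residues F e := by
    ext v
    rw [Finset.mem_filter, mem_residues, mem_residues]
    refine ⟨fun h => h.2, fun h => ⟨lt_of_lt_of_le h ?_, h⟩⟩
    exact_mod_cast Nat.le_add_left e m
  rw [hfilter, ← Finset.mul_sum, ← gaussSum_quadraticCharC_sq hq hψ, ← pow_mul]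
  interval_cases e
  · rw [residues_zero, Finset.sum_singleton]
    simp only [ne_eq, OfNat.ofNat_ne_zero, not_false_eq_true, zero_pow, mul_zero]
    rw [show residueAt D 0 = 0 by simp [residueAt], AddChar.map_zero_eq_one, mul_one]
    congr 1
    omega
  · rw [sum_residues_one]
    have : ∀ c : F, residueAt D (X ^ (m + m) * C c ^ 2) = c ^ 2 := by
      intro c
      rw [mul_comm, ← C_pow, residueAt_C_mul, residueAt_of_degree_lt hD, coeff_X_pow,
        if_pos (by omega), mul_one]
      rw [degree_X_pow, Nat.cast_lt]
      omega
    simp only [this]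
    rw [← gaussSum_quadraticCharC hF hψ, ← pow_succ]
    congr 1
    omega

/-! ### Gauss sums of quadratic symbols -/

theorem sum_residues_mk {P : F[X]} (hP : P.Monic) [Fintype (AdjoinRoot P)] {M : Type*}
    [AddCommMonoid M] (φ : AdjoinRoot P → M) :
    ∑ f ∈ residues F P.natDegree, φ (AdjoinRoot.mk P f) = ∑ y, φ y := by
  refine Finset.sum_bij (fun f _ => AdjoinRoot.mk P f) (fun _ _ => Finset.mem_univ _) ?_ ?_ ?_
  · intro a ha b hb h
    rw [mem_residues, ← degree_eq_natDegree hP.ne_zero] at ha hb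
    rw [AdjoinRoot.mk_eq_mk] at h
    exact sub_eq_zero.1 (eq_zero_of_dvd_of_degree_lt h
      (lt_of_le_of_lt (degree_sub_le _ _) (max_lt ha hb)))
  · intro y _
    obtain ⟨f, rfl⟩ := AdjoinRoot.mk_surjective y
    refine ⟨f %ₘ P, ?_, ?_⟩
    · rw [mem_residues, ← degree_eq_natDegree hP.ne_zero]
      exact degree_modByMonic_lt _ hP
    · rw [AdjoinRoot.mk_eq_mk, modByMonic_eq_sub_mul_div]
      exact ⟨-(f /ₘ P), by ring⟩
  · intros; rfl

/-- The Gauss sum of the symbol to the modulus `D`, twisted by `h`. -/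
def symbolGaussSum (ψ : AddChar F ℂ) (D h : F[X]) : ℂ :=
  ∑ f ∈ residues F D.natDegree, (symbol D f : ℂ) * ψ (residueAt D (f * h))

theorem symbolGaussSum_of_irreducible (hq : Fintype.card F ≡ 1 [MOD 4]) {ψ : AddChar F ℂ}
    (hψ : ψ ≠ 1) {P : F[X]} (hP : P.Monic) (hirr : Irreducible P) (h : F[X]) :
    symbolGaussSum ψ P h = symbol P h * gaussSum (quadraticCharC F) ψ ^ P.natDegree := by
  classical
  have hF := ringChar_ne_two hq
  have : Fact (Irreducible P) := ⟨hirr⟩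
  have := finite_adjoinRoot hP
  have := Fintype.ofFinite (AdjoinRoot P)
  have hK : ringChar (AdjoinRoot P) ≠ 2 := Algebra.ringChar_eq F (AdjoinRoot P) ▸ hF
  set ℓ : AdjoinRoot P →ₗ[F] F :=
    (lcoeff F (P.natDegree - 1)).comp (AdjoinRoot.modByMonicHom hP) with hℓ
  have hℓmk : ∀ f, ℓ (AdjoinRoot.mk P f) = residueAt P f := fun f => by
    simp [hℓ, residueAt, AdjoinRoot.modByMonicHom_mk]
  set Ψ : AddChar (AdjoinRoot P) ℂ := ψ.compAddMonoidHom ℓ.toAddMonoidHom with hΨ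
  have hΨmk : ∀ f, Ψ (AdjoinRoot.mk P f) = ψ (residueAt P f) := fun f => by
    rw [← hℓmk]; rfl
  have hd := hirr.natDegree_pos
  have hΨ1 : Ψ ≠ 1 := by
    obtain ⟨c, hc⟩ : ∃ c, ψ c ≠ 1 := by
      by_contra! hall
      exact hψ (by ext c; simpa using hall c)
    intro h1
    apply hc
    have h2 := hΨmk (C c * X ^ (P.natDegree - 1))
    rw [h1, AddChar.one_apply, residueAt_C_mul, residueAt_of_degree_lt hP, coeff_X_pow,
      if_pos rfl, mul_one] at h2
    · exact h2.symm
    · rw [degree_X_pow, Nat.cast_lt]; omega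
  have hsum : symbolGaussSum ψ P h =
      ∑ y, quadraticCharC (AdjoinRoot P) y * Ψ (y * AdjoinRoot.mk P h) := by
    rw [← sum_residues_mk hP, symbolGaussSum]
    refine Finset.sum_congr rfl fun f _ => ?_
    rw [← map_mul, hΨmk, quadraticCharC_apply, ← symbol_eq_quadraticChar_mk hF hP]
  have hone : gaussSum (quadraticCharC (AdjoinRoot P)) Ψ =
      gaussSum (quadraticCharC F) ψ ^ P.natDegree := by
    rw [gaussSum_quadraticCharC hK hΨ1, ← sum_residues_mk hP, ← sum_addChar_residueAt_sq hq hψ hP]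
    refine Finset.sum_congr rfl fun f _ => ?_
    rw [← map_pow, hΨmk]
  rcases eq_or_ne (AdjoinRoot.mk P h) 0 with h0 | h0
  · rw [hsum, symbol_eq_quadraticChar_mk hF hP, h0, quadraticChar_zero, Int.cast_zero, zero_mul]
    simp only [mul_zero, AddChar.map_zero_eq_one, mul_one, quadraticCharC_apply]
    rw [← Int.cast_sum, quadraticChar_sum_zero hK, Int.cast_zero]
  · have h1 := gaussSum_mulShift (quadraticCharC (AdjoinRoot P)) Ψ (Units.mk0 _ h0)
    have h2 : gaussSum (quadraticCharC (AdjoinRoot P))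
        (AddChar.mulShift Ψ (Units.mk0 _ h0 : (AdjoinRoot P)ˣ)) = symbolGaussSum ψ P h := by
      rw [hsum, gaussSum]
      refine Finset.sum_congr rfl fun y _ => ?_
      rw [AddChar.mulShift_apply, Units.val_mk0, mul_comm y]
    rw [h2, hone, Units.val_mk0, quadraticCharC_apply, ← symbol_eq_quadraticChar_mk hF hP] at h1
    have h3 : (symbol P h : ℂ) * symbol P h = 1 := by
      have : symbol P h * symbol P h = 1 := by
        rw [← sq, symbol_eq_quadraticChar_mk hF hP, quadraticChar_sq_one h0]
      exact_mod_cast this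
    rw [← h1, ← mul_assoc, h3, one_mul]

theorem symbolGaussSum_mul (hq : Fintype.card F ≡ 1 [MOD 4]) (ψ : AddChar F ℂ) {A B : F[X]}
    (hA : A.Monic) (hB : B.Monic) (hAB : IsCoprime A B) (h : F[X]) :
    symbolGaussSum ψ (A * B) h = symbolGaussSum ψ A h * symbolGaussSum ψ B h := by
  rw [symbolGaussSum, hA.natDegree_mul hB, sum_residues_mul hA hB hAB, symbolGaussSum,
    symbolGaussSum, Finset.sum_mul_sum]
  refine Finset.sum_congr rfl fun f _ => Finset.sum_congr rfl fun g _ => ?_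
  have hrec : symbol A B * symbol B A = 1 := by
    rw [symbol_comm hq B A, ← sq, symbol_sq hA hAB]
  have h1 : symbol (A * B) (f * B + g * A) = symbol A f * symbol B g := by
    rw [symbol_mul_left hA hB, mul_comm g A, symbol_add_mul hA, add_comm (f * B), mul_comm f B,
      symbol_add_mul hB, symbol_mul_right hA, symbol_mul_right hB]
    linear_combination symbol A f * symbol B g * hrec
  have h2 : residueAt (A * B) ((f * B + g * A) * h) = residueAt A (f * h) + residueAt B (g * h) := by
    rw [add_mul, residueAt_add, show f * B * h = B * (f * h) by ring,
      show g * A * h = A * (g * h) by ring, residueAt_mul_cancel hA hB, mul_comm A B,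
      residueAt_mul_cancel hB hA]
  rw [h1, h2, AddChar.map_add_eq_mul, Int.cast_mul]
  ring

omit [Fintype F] in
theorem exists_monic_irreducible_mul {D : F[X]} (hD : D.Monic) (h1 : D ≠ 1) :
    ∃ P E : F[X], P.Monic ∧ Irreducible P ∧ E.Monic ∧ D = P * E := by
  obtain ⟨P, hPm, hirr, E, hE⟩ :=
    exists_monic_irreducible_factor D (fun hu => h1 (hD.eq_one_of_isUnit hu))
  exact ⟨P, E, hPm, hirr, hPm.of_mul_monic_left (hE ▸ hD), hE⟩

/-- Squarefree moduli give primitive symbols: the Gauss sum has the value `τ ^ deg D` with `τ` the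
quadratic Gauss sum of `F`, and its twist by `h` is proportional to the symbol of `h`, also for
`h` not coprime to `D`. -/
theorem symbolGaussSum_of_squarefree (hq : Fintype.card F ≡ 1 [MOD 4]) {ψ : AddChar F ℂ}
    (hψ : ψ ≠ 1) {D : F[X]} (hD : D.Monic) (hsq : Squarefree D) (h : F[X]) :
    symbolGaussSum ψ D h = symbol D h * gaussSum (quadraticCharC F) ψ ^ D.natDegree := by
  induction hn : D.natDegree using Nat.strong_induction_on generalizing D with
  | _ n ih =>
    subst hn
    rcases eq_or_ne D 1 with rfl | h1
    · rw [symbolGaussSum, natDegree_one, residues_zero, Finset.sum_singleton]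
      simp [residueAt]
    obtain ⟨P, E, hPm, hirr, hEm, rfl⟩ := exists_monic_irreducible_mul hD h1
    have hcop : IsCoprime P E := by
      rw [hirr.coprime_iff_not_dvd]
      rintro ⟨G, rfl⟩
      exact hirr.not_isUnit (hsq P ⟨G, by ring⟩)
    have hdeg := hPm.natDegree_mul hEm
    have hpos := hirr.natDegree_pos
    rw [symbolGaussSum_mul hq ψ hPm hEm hcop, symbolGaussSum_of_irreducible hq hψ hPm hirr,
      ih E.natDegree (by omega) hEm (hsq.squarefree_of_dvd (dvd_mul_left _ _)) rfl,
      symbol_mul_left hPm hEm, hdeg, pow_add, Int.cast_mul]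
    ring

/-! ### The `L`-polynomial and its functional equation -/

/-- The coefficient `∑ χ_D(f)`, over monic `f` of degree `n`, of the `L`-function of `D`. -/
def lCoeff (D : F[X]) (n : ℕ) : ℤ := ∑ f ∈ monics F n, symbol D f

theorem lCoeff_eq_zero (hF : ringChar F ≠ 2) {D : F[X]} (hD : D.Monic) (hodd : Odd D.natDegree)
    {n : ℕ} (hn : D.natDegree ≤ n) : lCoeff D n = 0 := by
  rw [lCoeff, sum_monics_periodic hD hn _ (symbol_add_mul hD),
    sum_symbol_eq_zero_of_odd hF hD hodd, smul_zero]

theorem lCoeff_zero (D : F[X]) : lCoeff D 0 = 1 := by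
  rw [lCoeff, monics_zero, Finset.sum_singleton, symbol_one_right]

/-- Sorting polynomials of degree at most `M` by their leading coefficient; those of degree less
than `M` contribute nothing. -/
theorem sum_symbol_mul_addChar_coeff (hF : ringChar F ≠ 2) (ψ : AddChar F ℂ) {D : F[X]}
    (hD : D.Monic) (hodd : Odd D.natDegree) (M : ℕ) :
    ∑ h ∈ residues F (M + 1), (symbol D h : ℂ) * ψ (h.coeff M) =
      gaussSum (quadraticCharC F) ψ * lCoeff D M := by
  classical
  rw [sum_residues_add, Finset.sum_comm, sum_residues_one, gaussSum, Finset.sum_mul]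
  refine Finset.sum_congr rfl fun c _ => ?_
  have hcoeff : ∀ w ∈ residues F M, (w + X ^ M * C c).coeff M = c := by
    intro w hw
    rw [mem_residues] at hw
    rw [coeff_add, coeff_eq_zero_of_degree_lt hw, coeff_mul_C, coeff_X_pow, if_pos rfl, one_mul,
      zero_add]
  have h1 : ∑ w ∈ residues F M, (symbol D (w + X ^ M * C c) : ℂ) * ψ ((w + X ^ M * C c).coeff M) =
      ((∑ w ∈ residues F M, symbol D (w + X ^ M * C c) : ℤ) : ℂ) * ψ c := by
    rw [Int.cast_sum, Finset.sum_mul]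
    exact Finset.sum_congr rfl fun w hw => by rw [hcoeff w hw]
  have h2 : ∑ w ∈ residues F M, symbol D (w + X ^ M * C c) = quadraticChar F c * lCoeff D M := by
    rcases eq_or_ne c 0 with rfl | hc
    · simp only [C_0, mul_zero, add_zero, quadraticChar_zero, zero_mul]
      exact sum_symbol_eq_zero_of_odd hF hD hodd M
    · rw [lCoeff, sum_monics, Finset.mul_sum]
      refine Finset.sum_bij' (fun w _ => C c⁻¹ * w) (fun w _ => C c * w) ?_ ?_ ?_ ?_ ?_
      · intro f hf
        rw [mem_residues] at hf ⊢
        rwa [degree_C_mul (inv_ne_zero hc)]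
      · intro f hf
        rw [mem_residues] at hf ⊢
        rwa [degree_C_mul hc]
      · intro f _
        rw [← mul_assoc, ← C_mul, mul_inv_cancel₀ hc, C_1, one_mul]
      · intro f _
        rw [← mul_assoc, ← C_mul, inv_mul_cancel₀ hc, C_1, one_mul]
      · intro f _
        have h3 : symbol D (C c) = quadraticChar F c := by
          rw [symbol_C]
          rcases quadraticChar_dichotomy hc with h | h <;> rw [h]
          · rw [one_pow]
          · rw [hodd.neg_one_pow]
        rw [← h3, ← symbol_mul_right hD]
        congr 1
        rw [mul_add, ← mul_assoc, ← C_mul, mul_inv_cancel₀ hc, C_1, one_mul,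
          mul_comm (C c), add_comm]
  rw [h1, h2, quadraticCharC_apply, Int.cast_mul]
  ring

/-- The functional equation. Expand the symbol by its Gauss sum and sum over the `q ^ n` lower
parts of a monic polynomial of degree `n` by orthogonality. -/
theorem lCoeff_functional_equation (hq : Fintype.card F ≡ 1 [MOD 4]) {D : F[X]} (hD : D.Monic)
    (hsq : Squarefree D) {g : ℕ} (hg : D.natDegree = 2 * g + 1) {n : ℕ} (hn : n ≤ 2 * g) :
    (Fintype.card F : ℤ) ^ g * lCoeff D n = (Fintype.card F : ℤ) ^ n * lCoeff D (2 * g - n) := by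
  classical
  have hF := ringChar_ne_two hq
  have hodd : Odd D.natDegree := ⟨g, hg⟩
  set ψ := AddChar.FiniteField.primitiveChar_to_Complex F
  have hψ : ψ ≠ 1 := by
    have := AddChar.FiniteField.primitiveChar_to_Complex_isPrimitive F one_ne_zero
    rwa [AddChar.mulShift_one] at this
  set τ := gaussSum (quadraticCharC F) ψ with hτdef
  have hτ : τ ^ 2 = Fintype.card F := gaussSum_quadraticCharC_sq hq hψ
  have hτ0 : τ ≠ 0 := by
    intro h
    rw [h, zero_pow two_ne_zero] at hτ
    exact Nat.cast_ne_zero.2 Fintype.card_ne_zero hτ.symm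
  have h1 : τ ^ (2 * g + 1) * lCoeff D n = (Fintype.card F : ℂ) ^ n * (τ * lCoeff D (2 * g - n)) := by
    calc τ ^ (2 * g + 1) * lCoeff D n
        = ∑ r ∈ residues F n, symbolGaussSum ψ D (X ^ n + r) := by
          rw [lCoeff, sum_monics, Int.cast_sum, Finset.mul_sum]
          refine Finset.sum_congr rfl fun r _ => ?_
          rw [symbolGaussSum_of_squarefree hq hψ hD hsq, hg, mul_comm]
      _ = ∑ h ∈ residues F D.natDegree, (symbol D h : ℂ) * ψ (residueAt D (X ^ n * h)) *
            ∑ r ∈ residues F n, ψ (residueAt D (r * h)) := by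
          simp only [symbolGaussSum, Finset.mul_sum]
          rw [Finset.sum_comm]
          refine Finset.sum_congr rfl fun h _ => Finset.sum_congr rfl fun r _ => ?_
          rw [mul_add, residueAt_add, AddChar.map_add_eq_mul, mul_comm h, mul_comm h]
          ring
      _ = ∑ h ∈ residues F D.natDegree, if h.degree < ((D.natDegree - n : ℕ) : WithBot ℕ) then
            (symbol D h : ℂ) * ψ (residueAt D (X ^ n * h)) * (Fintype.card F : ℂ) ^ n else 0 := by
          refine Finset.sum_congr rfl fun h hh => ?_
          rw [sum_addChar_residueAt hψ hD (by omega) (mem_residues.1 hh), mul_ite, mul_zero]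
      _ = ∑ h ∈ residues F (2 * g - n + 1),
            (symbol D h : ℂ) * ψ (h.coeff (2 * g - n)) * (Fintype.card F : ℂ) ^ n := by
          rw [← Finset.sum_filter]
          have hNn : D.natDegree - n = 2 * g - n + 1 := by omega
          have hfilter : {h ∈ residues F D.natDegree |
              h.degree < ((D.natDegree - n : ℕ) : WithBot ℕ)} = residues F (2 * g - n + 1) := by
            ext v
            rw [Finset.mem_filter, mem_residues, mem_residues, hNn]
            refine ⟨fun h => h.2, fun h => ⟨lt_of_lt_of_le h ?_, h⟩⟩
            rw [Nat.cast_le]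
            omega
          rw [hfilter]
          refine Finset.sum_congr rfl fun h hh => ?_
          have hd : (X ^ n * h).degree < (D.natDegree : WithBot ℕ) := by
            rw [mem_residues] at hh
            rw [degree_mul, degree_X_pow, show D.natDegree = n + (2 * g - n + 1) by omega,
              Nat.cast_add n]
            exact WithBot.add_lt_add_left (by simp) hh
          rw [residueAt_of_degree_lt hD hd, show D.natDegree - 1 = (2 * g - n) + n by omega,
            coeff_X_pow_mul]
      _ = _ := by
          rw [← Finset.sum_mul, sum_symbol_mul_addChar_coeff hF ψ hD hodd, mul_comm]
  have h2 : ((Fintype.card F : ℂ)) ^ g * lCoeff D n =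
      (Fintype.card F : ℂ) ^ n * lCoeff D (2 * g - n) := by
    apply mul_left_cancel₀ hτ0
    rw [pow_succ, pow_mul, hτ] at h1
    linear_combination h1
  exact_mod_cast h2

/-! ### Prime factorizations -/

open scoped Classical in
/-- The monic irreducible polynomials of degree at most `n`. -/
def primes (F : Type*) [Field F] [Fintype F] (n : ℕ) : Finset F[X] :=
  {P ∈ residues F (n + 1) | P.Monic ∧ Irreducible P}

theorem mem_primes {n : ℕ} {P : F[X]} :
    P ∈ primes F n ↔ P.Monic ∧ Irreducible P ∧ P.natDegree ≤ n := by
  classical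
  rw [primes, Finset.mem_filter, mem_residues, and_comm, and_assoc]
  refine and_congr_right fun hm => and_congr_right fun _ => ?_
  rw [degree_eq_natDegree hm.ne_zero, Nat.cast_lt, Nat.lt_succ_iff]

open scoped Classical in
/-- The degree of `f` is the sum of `deg P` over the prime powers `P ^ j` dividing `f`. -/
theorem sum_natDegree_primePowers_dvd {n : ℕ} {f : F[X]} (hf : f ∈ monics F n) :
    ∑ P ∈ primes F n, ∑ j ∈ Finset.Icc 1 n, (if P ^ j ∣ f then P.natDegree else 0) = n := by
  obtain ⟨hm, hd⟩ := mem_monics.1 hf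
  set s := UniqueFactorizationMonoid.normalizedFactors f with hs
  have hprod : s.prod = f := by
    rw [hs, UniqueFactorizationMonoid.prod_normalizedFactors_eq hm.ne_zero, hm.normalize_eq_self]
  have hmem : ∀ P ∈ s, P.Monic ∧ Irreducible P ∧ P.natDegree ≤ n := by
    intro P hP
    have hirr := UniqueFactorizationMonoid.irreducible_of_normalized_factor P hP
    refine ⟨(normalize_eq_self_iff_monic hirr.ne_zero).1
      (UniqueFactorizationMonoid.normalize_normalized_factor P hP), hirr, ?_⟩
    exact hd ▸ natDegree_le_of_dvd (UniqueFactorizationMonoid.dvd_of_mem_normalizedFactors hP)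
      hm.ne_zero
  have hdeg : n = ∑ P ∈ primes F n, s.count P * P.natDegree := by
    have h1 : f.natDegree = (s.map natDegree).sum := by
      conv_lhs => rw [← hprod]
      exact natDegree_multiset_prod_of_monic _ fun P hP => (hmem P hP).1
    conv_lhs => rw [← hd, h1, Finset.sum_multiset_map_count]
    simp only [smul_eq_mul]
    refine Finset.sum_subset (fun P hP => ?_) (fun P _ hP => ?_)
    · exact mem_primes.2 (hmem P (Multiset.mem_toFinset.1 hP))
    · rw [Multiset.count_eq_zero_of_notMem (fun h => hP (Multiset.mem_toFinset.2 h)), zero_mul]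
  have hcount : ∀ P ∈ primes F n, s.count P * P.natDegree =
      ∑ j ∈ Finset.Icc 1 n, (if P ^ j ∣ f then P.natDegree else 0) := by
    intro P hP
    have hle : s.count P * P.natDegree ≤ n := by
      conv_rhs => rw [hdeg]
      exact Finset.single_le_sum (f := fun P => s.count P * P.natDegree)
        (fun _ _ => Nat.zero_le _) hP
    obtain ⟨hPm, hirr, _⟩ := mem_primes.1 hP
    have hpos := hirr.natDegree_pos
    have hdvd : ∀ j, P ^ j ∣ f ↔ j ≤ s.count P := by
      intro j
      rw [pow_dvd_iff_le_emultiplicity,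
        UniqueFactorizationMonoid.emultiplicity_eq_count_normalizedFactors hirr hm.ne_zero,
        hPm.normalize_eq_self, Nat.cast_le]
    rw [← Finset.sum_filter, Finset.sum_const, smul_eq_mul]
    congr 1
    have : {j ∈ Finset.Icc 1 n | P ^ j ∣ f} = Finset.Icc 1 (s.count P) := by
      ext j
      rw [Finset.mem_filter, Finset.mem_Icc, Finset.mem_Icc, hdvd]
      have : s.count P ≤ n := (Nat.le_mul_of_pos_right _ hpos).trans hle
      omega
    rw [this, Nat.card_Icc, Nat.add_sub_cancel]
  rw [← Finset.sum_congr rfl hcount, ← hdeg]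

/-! ### The zeta function -/

/-- The prime power sum `∑ deg(P) χ_D(P) ^ (k / deg P)` over the primes `P` with `deg P ∣ k`: the
coefficients of the logarithmic derivative of the `L`-function of `D`. -/
def primePowerSum (D : F[X]) (k : ℕ) : ℤ :=
  ∑ P ∈ primes F k with P.natDegree ∣ k, (P.natDegree : ℤ) * symbol D P ^ (k / P.natDegree)

theorem primePowerSum_eq (D : F[X]) {k n : ℕ} (hk : 0 < k) (hkn : k ≤ n) :
    primePowerSum D k = ∑ P ∈ primes F n,
      if P.natDegree ∣ k then (P.natDegree : ℤ) * symbol D P ^ (k / P.natDegree) else 0 := by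
  rw [primePowerSum, ← Finset.sum_filter]
  congr 1
  ext P
  simp only [Finset.mem_filter, mem_primes]
  constructor
  · rintro ⟨⟨h1, h2, h3⟩, h4⟩
    exact ⟨⟨h1, h2, h3.trans hkn⟩, h4⟩
  · rintro ⟨⟨h1, h2, h3⟩, h4⟩
    exact ⟨⟨h1, h2, Nat.le_of_dvd hk h4⟩, h4⟩

/-- The coefficients of the identity `u L'(u) = L(u) ∑ k (u ^ k)`, where the sum has the
coefficients `primePowerSum`. -/
theorem mul_lCoeff {D : F[X]} (hD : D.Monic) (n : ℕ) :
    (n : ℤ) * lCoeff D n =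
      ∑ k ∈ Finset.Icc 1 n, primePowerSum D k * lCoeff D (n - k) := by
  classical
  have hL : (n : ℤ) * lCoeff D n = ∑ P ∈ primes F n, ∑ j ∈ Finset.Icc 1 n,
      if j * P.natDegree ≤ n then
        (P.natDegree : ℤ) * symbol D P ^ j * lCoeff D (n - j * P.natDegree) else 0 := by
    calc (n : ℤ) * lCoeff D n
        = ∑ f ∈ monics F n, ∑ P ∈ primes F n, ∑ j ∈ Finset.Icc 1 n,
            (if P ^ j ∣ f then (P.natDegree : ℤ) * symbol D f else 0) := by
          rw [lCoeff, Finset.mul_sum]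
          refine Finset.sum_congr rfl fun f hf => ?_
          have h := congrArg (Nat.cast (R := ℤ)) (sum_natDegree_primePowers_dvd hf)
          push_cast at h
          conv_lhs => rw [← h]
          rw [Finset.sum_mul]
          refine Finset.sum_congr rfl fun P _ => ?_
          rw [Finset.sum_mul]
          refine Finset.sum_congr rfl fun j _ => ?_
          rw [ite_mul, zero_mul]
      _ = ∑ P ∈ primes F n, ∑ j ∈ Finset.Icc 1 n, ∑ f ∈ monics F n with P ^ j ∣ f,
            (P.natDegree : ℤ) * symbol D f := by
          rw [Finset.sum_comm]
          refine Finset.sum_congr rfl fun P _ => ?_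
          rw [Finset.sum_comm]
          refine Finset.sum_congr rfl fun j _ => ?_
          rw [Finset.sum_filter]
      _ = _ := by
          refine Finset.sum_congr rfl fun P hP => Finset.sum_congr rfl fun j _ => ?_
          obtain ⟨hPm, -, -⟩ := mem_primes.1 hP
          rw [sum_monics_dvd (hPm.pow j), hPm.natDegree_pow]
          refine if_congr Iff.rfl ?_ rfl
          rw [lCoeff, Finset.mul_sum]
          refine Finset.sum_congr rfl fun f _ => ?_
          rw [symbol_mul_right hD, symbol_pow_right hD]
          ring
  have hR : ∑ k ∈ Finset.Icc 1 n, primePowerSum D k * lCoeff D (n - k) =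
      ∑ P ∈ primes F n, ∑ k ∈ Finset.Icc 1 n, if P.natDegree ∣ k then
        (P.natDegree : ℤ) * symbol D P ^ (k / P.natDegree) * lCoeff D (n - k) else 0 := by
    rw [Finset.sum_comm]
    refine Finset.sum_congr rfl fun k hk => ?_
    rw [Finset.mem_Icc] at hk
    rw [primePowerSum_eq D (by omega) hk.2, Finset.sum_mul]
    refine Finset.sum_congr rfl fun P _ => ?_
    rw [ite_mul, zero_mul]
  rw [hL, hR]
  refine Finset.sum_congr rfl fun P hP => ?_
  have hpos := (mem_primes.1 hP).2.1.natDegree_pos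
  rw [← Finset.sum_filter, ← Finset.sum_filter]
  refine Finset.sum_bij (fun j _ => j * P.natDegree) ?_ ?_ ?_ ?_
  · intro j hj
    rw [Finset.mem_filter, Finset.mem_Icc] at hj ⊢
    exact ⟨⟨Nat.mul_pos (by omega) hpos, hj.2⟩, dvd_mul_left _ _⟩
  · intro a _ b _ h
    exact Nat.eq_of_mul_eq_mul_right hpos h
  · intro k hk
    rw [Finset.mem_filter, Finset.mem_Icc] at hk
    obtain ⟨⟨h1, h2⟩, j, rfl⟩ := hk
    refine ⟨j, ?_, mul_comm _ _⟩
    rw [Finset.mem_filter, Finset.mem_Icc]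
    refine ⟨⟨?_, ?_⟩, by rwa [mul_comm]⟩
    · exact Nat.pos_of_ne_zero (by rintro rfl; simp at h1)
    · exact (Nat.le_mul_of_pos_left j hpos).trans h2
  · intro j _
    rw [Nat.mul_div_cancel _ hpos]

open scoped Classical in
theorem card_minpoly_eq {K : Type*} [Field K] [Fintype K] [Algebra F K] {P : F[X]} (hP : P.Monic)
    (hirr : Irreducible P) :
    ({x : K | minpoly F x = P} : Finset K).card =
      if P.natDegree ∣ Module.finrank F K then P.natDegree else 0 := by
  have hfin : FiniteDimensional F K := Module.Finite.of_finite
  split_ifs with h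
  · have hsep : P.Separable := PerfectField.separable_of_irreducible hirr
    have hdvd := hirr.natDegree_dvd_iff_dvd_X_pow_card_pow_sub_X.1 h
    have hcard : Nat.card F ^ Module.finrank F K = Fintype.card K := by
      rw [Nat.card_eq_fintype_card, ← Module.card_eq_pow_finrank]
    rw [hcard] at hdvd
    have hsplits : (P.map (algebraMap F K)).Splits := by
      have h1 : P.map (algebraMap F K) ∣ X ^ Fintype.card K - X := by
        have := Polynomial.map_dvd (algebraMap F K) hdvd
        simpa using this
      refine Splits.of_dvd ?_ (FiniteField.X_pow_card_sub_X_ne_zero K Fintype.one_lt_card) h1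
      rw [splits_iff_card_roots, FiniteField.roots_X_pow_card_sub_X,
        FiniteField.X_pow_card_sub_X_natDegree_eq K Fintype.one_lt_card]
      rfl
    rw [← card_rootSet_eq_natDegree hsep hsplits, ← Set.toFinset_card]
    congr 1
    ext x
    rw [Finset.mem_filter, Set.mem_toFinset, mem_rootSet_of_ne hP.ne_zero]
    refine ⟨fun hx => by rw [← hx.2]; exact minpoly.aeval F x, fun hx => ⟨Finset.mem_univ _, ?_⟩⟩
    exact (minpoly.eq_of_irreducible_of_monic hirr hx hP).symm
  · rw [Finset.card_eq_zero, Finset.filter_eq_empty_iff]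
    intro x _ hx
    exact h (hx ▸ minpoly.degree_dvd (IsIntegral.of_finite F x))

open scoped Classical IntermediateField in
/-- Grouping the points of an extension field by their minimal polynomials. -/
theorem sum_quadraticChar_aeval (hq : Fintype.card F ≡ 1 [MOD 4]) {K : Type*} [Field K] [Fintype K]
    [Algebra F K] {k : ℕ} (hk : 0 < k) (hK : Module.finrank F K = k) (D : F[X]) :
    ∑ x : K, quadraticChar K (aeval x D) = primePowerSum D k := by
  have hfin : FiniteDimensional F K := Module.Finite.of_finite
  have hmin : ∀ x : K, minpoly F x ∈ primes F k := fun x => by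
    have hx := IsIntegral.of_finite F x
    exact mem_primes.2 ⟨minpoly.monic hx, minpoly.irreducible hx,
      Nat.le_of_dvd hk (hK ▸ minpoly.degree_dvd hx)⟩
  rw [← Finset.sum_fiberwise_of_maps_to (fun x _ => hmin x), primePowerSum_eq D hk le_rfl]
  refine Finset.sum_congr rfl fun P hP => ?_
  obtain ⟨hPm, hirr, -⟩ := mem_primes.1 hP
  have hterm : ∀ x ∈ ({x : K | minpoly F x = P} : Finset K),
      quadraticChar K (aeval x D) = symbol D P ^ (k / P.natDegree) := by
    intro x hx
    rw [Finset.mem_filter] at hx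
    rw [quadraticChar_aeval (ringChar_ne_two hq), hx.2, symbol_comm hq]
    congr 1
    have h1 := Module.finrank_mul_finrank F F⟮x⟯ K
    rw [IntermediateField.adjoin.finrank (IsIntegral.of_finite F x), hx.2, hK] at h1
    rw [← h1, Nat.mul_div_cancel_left _ hirr.natDegree_pos]
  rw [Finset.sum_congr rfl hterm, Finset.sum_const, card_minpoly_eq hPm hirr, hK, nsmul_eq_mul]
  split_ifs <;> simp

theorem pointCount_eq (hq : Fintype.card F ≡ 1 [MOD 4]) {D : F[X]} {g : ℕ}
    (hg : D.natDegree = 2 * g + 1) (n : ℕ) [NeZero n] :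
    (pointCount D n : ℤ) = 1 + (Fintype.card F : ℤ) ^ n + primePowerSum D n := by
  classical
  have : Fact (ringChar F).Prime := ⟨CharP.char_is_prime F (ringChar F)⟩
  set K := FiniteField.Extension F (ringChar F) n with hKdef
  have hfinite : Finite K := Module.finite_of_finite F
  have := Fintype.ofFinite K
  have hrank : Module.finrank F K = n := FiniteField.finrank_extension F (ringChar F) n
  have hF := ringChar_ne_two hq
  have hK : ringChar K ≠ 2 := Algebra.ringChar_eq F K ▸ hF
  have hgen : genus D = g := by rw [genus, hg]; omega
  have h1 : Nat.card {p : K × K // p.2 ^ 2 = aeval p.1 D} =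
      ∑ x : K, ({y : K | y ^ 2 = aeval x D} : Finset K).card := by
    rw [Nat.card_eq_fintype_card, Fintype.card_subtype, Finset.card_filter,
      ← Finset.univ_product_univ, Finset.sum_product]
    refine Finset.sum_congr rfl fun x _ => ?_
    rw [Finset.card_filter]
  have h2 : Nat.card {v : K // v ^ 2 = aeval (0 : K) (reflect (2 * genus D + 2) D)} = 1 := by
    have h0 : aeval (0 : K) (reflect (2 * genus D + 2) D) = 0 := by
      rw [← coeff_zero_eq_aeval_zero', coeff_reflect, revAt_le (Nat.zero_le _), Nat.sub_zero,
        coeff_eq_zero_of_natDegree_lt (by rw [hgen, hg]; omega), map_zero]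
    rw [h0, Nat.card_eq_one_iff_unique]
    refine ⟨⟨fun a b => Subtype.ext ?_⟩, ⟨⟨0, by simp⟩⟩⟩
    rw [pow_eq_zero_iff two_ne_zero |>.1 a.2, pow_eq_zero_iff two_ne_zero |>.1 b.2]
  have h3 : pointCount D n = Nat.card (CurvePoints D K) := rfl
  have h4 : ∀ x : K, ((({y : K | y ^ 2 = aeval x D} : Finset K).card : ℕ) : ℤ) =
      quadraticChar K (aeval x D) + 1 := by
    intro x
    rw [← quadraticChar_card_sqrts hK]
    congr 2
    ext; simp
  rw [h3, CurvePoints, Nat.card_sum, h1, h2]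
  push_cast
  simp only [h4]
  rw [Finset.sum_add_distrib, sum_quadraticChar_aeval hq (NeZero.pos n) hrank]
  have h5 : (Fintype.card K : ℤ) = (Fintype.card F : ℤ) ^ n := by
    rw [Module.card_eq_pow_finrank (K := F) (V := K), hrank]
    push_cast; rfl
  simp only [Finset.sum_const, Finset.card_univ, nsmul_eq_mul, mul_one, h5]
  ring

open scoped PowerSeries in
/-- A power series is determined by its logarithmic derivative and its constant term. -/
theorem powerSeries_eq_of_derivative_eq_mul {f g s : PowerSeries ℚ} (hf : d⁄dX ℚ f = f * s)
    (hg : d⁄dX ℚ g = g * s) (h0 : PowerSeries.constantCoeff f = PowerSeries.constantCoeff g) :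
    f = g := by
  ext n
  induction n using Nat.strong_induction_on with
  | _ n ih =>
    cases n with
    | zero => simpa using h0
    | succ n =>
      have h1 := congrArg (PowerSeries.coeff n) hf
      have h2 := congrArg (PowerSeries.coeff n) hg
      rw [PowerSeries.coeff_derivative, PowerSeries.coeff_mul] at h1 h2
      have h3 : ∑ p ∈ Finset.HasAntidiagonal.antidiagonal n,
            PowerSeries.coeff p.1 f * PowerSeries.coeff p.2 s =
          ∑ p ∈ Finset.HasAntidiagonal.antidiagonal n,
            PowerSeries.coeff p.1 g * PowerSeries.coeff p.2 s := by
        refine Finset.sum_congr rfl fun p hp => ?_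
        have := Finset.HasAntidiagonal.mem_antidiagonal.1 hp
        rw [ih p.1 (by omega)]
      have h4 : ((n : ℚ) + 1) ≠ 0 := by positivity
      exact mul_right_cancel₀ h4 (by rw [h1, h2, h3])

open scoped PowerSeries in
/-- The numerator of the zeta function of `y² = D(x)` is the `L`-function of `D`. -/
theorem numeratorSeries_eq (hq : Fintype.card F ≡ 1 [MOD 4]) {D : F[X]} (hD : D.Monic) {g : ℕ}
    (hg : D.natDegree = 2 * g + 1) :
    numeratorSeries D = PowerSeries.mk fun n => (lCoeff D n : ℚ) := by
  set q : ℚ := (Fintype.card F : ℚ) with hqdef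
  set s : PowerSeries ℚ := PowerSeries.mk fun n => (primePowerSum D (n + 1) : ℚ) with hs
  set u : PowerSeries ℚ := PowerSeries.mk fun _ => 1 with hu
  set v : PowerSeries ℚ := PowerSeries.mk fun n => q ^ (n + 1) with hv
  have hu1 : (1 - PowerSeries.X) * u = 1 := by
    rw [mul_comm, hu]
    exact PowerSeries.mk_one_mul_one_sub_eq_one ℚ
  have hv1 : (1 - PowerSeries.C q * PowerSeries.X) * v = PowerSeries.C q := by
    ext n
    rw [sub_mul, one_mul, map_sub, mul_assoc, PowerSeries.coeff_C_mul]
    cases n with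
    | zero => simp [hv]
    | succ n =>
      rw [PowerSeries.coeff_succ_X_mul, hv, PowerSeries.coeff_mk, PowerSeries.coeff_mk, PowerSeries.coeff_C,
        if_neg (Nat.succ_ne_zero n)]
      ring
  have hℓ0 : PowerSeries.constantCoeff (logZeta D) = 0 := by
    rw [← PowerSeries.coeff_zero_eq_constantCoeff_apply, logZeta, PowerSeries.coeff_mk]
  have hℓ : d⁄dX ℚ (logZeta D) = u + v + s := by
    ext n
    have h := congrArg (Int.cast (R := ℚ)) (pointCount_eq hq hg (n + 1))
    push_cast at h
    have hc : PowerSeries.coeff (n + 1) (logZeta D) =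
        (pointCount D (n + 1) : ℚ) / ((n + 1 : ℕ) : ℚ) := by
      rw [logZeta, PowerSeries.coeff_mk]
    rw [PowerSeries.coeff_derivative, hc, map_add, map_add, hu, hv, hs, PowerSeries.coeff_mk, PowerSeries.coeff_mk,
      PowerSeries.coeff_mk, h, hqdef, Nat.cast_succ, div_mul_cancel₀]
    positivity
  have hsub := PowerSeries.HasSubst.of_constantCoeff_zero' hℓ0
  have hZ : d⁄dX ℚ (zetaSeries D) = zetaSeries D * (u + v + s) := by
    rw [zetaSeries, PowerSeries.derivative_subst hsub, PowerSeries.derivative_exp, hℓ]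
  have hZ0 : PowerSeries.constantCoeff (zetaSeries D) = 1 := by
    have h1 : MvPowerSeries.constantCoeff ((PowerSeries.exp ℚ - 1).subst (logZeta D)) = 0 :=
      PowerSeries.constantCoeff_subst_eq_zero hℓ0 _ (by simp)
    have h2 : (PowerSeries.exp ℚ - 1).subst (logZeta D) = zetaSeries D - 1 := by
      rw [zetaSeries, ← PowerSeries.coe_substAlgHom hsub, map_sub, map_one]
    rw [h2] at h1
    have h3 : PowerSeries.constantCoeff (zetaSeries D - 1) = 0 := h1
    rw [map_sub, map_one, sub_eq_zero] at h3
    exact h3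
  refine powerSeries_eq_of_derivative_eq_mul (s := s) ?_ ?_ ?_
  · have hX : d⁄dX ℚ (1 - PowerSeries.X : PowerSeries ℚ) = -1 := by simp
    have hqX : d⁄dX ℚ (1 - PowerSeries.C q * PowerSeries.X : PowerSeries ℚ) = -PowerSeries.C q := by
      simp [Derivation.leibniz]
    rw [numeratorSeries, Derivation.leibniz, Derivation.leibniz, hX, hqX, hZ]
    simp only [smul_eq_mul]
    linear_combination (1 - PowerSeries.C q * PowerSeries.X) * zetaSeries D * hu1 +
      (1 - PowerSeries.X) * zetaSeries D * hv1
  · ext n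
    rw [mul_comm _ s, PowerSeries.coeff_derivative, PowerSeries.coeff_mk, PowerSeries.coeff_mul]
    have h := congrArg (Int.cast (R := ℚ)) (mul_lCoeff hD (n + 1))
    push_cast at h
    have hIcc : Finset.Icc 1 (n + 1) = Finset.Ico 1 (n + 2) := by
      ext j
      rw [Finset.mem_Icc, Finset.mem_Ico]
      omega
    rw [mul_comm, h, Finset.Nat.sum_antidiagonal_eq_sum_range_succ_mk, hIcc,
      Finset.sum_Ico_eq_sum_range]
    refine Finset.sum_congr rfl fun k _ => ?_
    simp only [hs, PowerSeries.coeff_mk]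
    rw [add_comm 1 k, Nat.add_sub_add_right]
  · rw [numeratorSeries]
    simp only [map_mul, map_sub, hZ0]
    simp [← PowerSeries.coeff_zero_eq_constantCoeff_apply, lCoeff_zero]

open scoped PowerSeries in
theorem numeratorSeries_eq_zetaNumerator (hq : Fintype.card F ≡ 1 [MOD 4]) {D : F[X]}
    (hD : D.Monic) {g : ℕ} (hg : D.natDegree = 2 * g + 1) :
    numeratorSeries D = (zetaNumerator D : PowerSeries ℚ) := by
  have hgen : genus D = g := by rw [genus, hg]; omega
  ext n
  rw [zetaNumerator, Polynomial.coeff_coe, PowerSeries.coeff_trunc, hgen]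
  split_ifs with h
  · rfl
  · rw [numeratorSeries_eq hq hD hg, PowerSeries.coeff_mk, lCoeff_eq_zero (ringChar_ne_two hq) hD ⟨g, hg⟩
      (by omega), Int.cast_zero]

theorem aeval_zetaNumerator (hq : Fintype.card F ≡ 1 [MOD 4]) {D : F[X]}
    (hD : D.Monic) {g : ℕ} (hg : D.natDegree = 2 * g + 1) (x : ℝ) :
    aeval x (zetaNumerator D) = ∑ n ∈ Finset.range (2 * g + 1), (lCoeff D n : ℝ) * x ^ n := by
  have hgen : genus D = g := by rw [genus, hg]; omega
  have hcoeff : ∀ n ∈ Finset.range (2 * g + 1), (zetaNumerator D).coeff n = lCoeff D n := by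
    intro n hn
    rw [zetaNumerator, hgen, PowerSeries.coeff_trunc, if_pos (Finset.mem_range.1 hn),
      numeratorSeries_eq hq hD hg, PowerSeries.coeff_mk]
  have hdeg : (zetaNumerator D).natDegree < 2 * g + 1 := by
    rw [zetaNumerator, hgen]
    exact PowerSeries.natDegree_trunc_lt _ _
  rw [aeval_eq_sum_range' hdeg]
  refine Finset.sum_congr rfl fun n hn => ?_
  rw [hcoeff n hn, Algebra.smul_def]
  simp

/-! ### The number of square-free polynomials -/

omit [Fintype F] in
theorem exists_sq_mul_squarefree {f : F[X]} (hf : f.Monic) :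
    ∃ A B : F[X], A.Monic ∧ B.Monic ∧ Squarefree B ∧ f = A ^ 2 * B := by
  classical
  induction hn : f.natDegree using Nat.strong_induction_on generalizing f with
  | _ n ih =>
    subst hn
    by_cases hsq : Squarefree f
    · exact ⟨1, f, monic_one, hf, hsq, by ring⟩
    · obtain ⟨x, hx, hxu⟩ : ∃ x, x * x ∣ f ∧ ¬ IsUnit x := by
        simpa [Squarefree] using hsq
      have hx0 : x ≠ 0 := by
        rintro rfl
        rw [zero_mul, zero_dvd_iff] at hx
        exact hf.ne_zero hx
      have hxm : (normalize x).Monic := monic_normalize hx0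
      obtain ⟨E, hE⟩ : normalize x * normalize x ∣ f :=
        ((normalize_associated x).mul_mul (normalize_associated x)).dvd_iff_dvd_left.2 hx
      have hEm : E.Monic := (hxm.mul hxm).of_mul_monic_left (hE ▸ hf)
      have hpos : 0 < (normalize x).natDegree := by
        rw [natDegree_eq_of_degree_eq (degree_normalize)]
        exact Nat.pos_of_ne_zero fun h => hxu (isUnit_iff_degree_eq_zero.2
          (by rw [degree_eq_natDegree hx0, h]; rfl))
      have hdeg : f.natDegree = (normalize x).natDegree + (normalize x).natDegree + E.natDegree := by
        rw [hE, (hxm.mul hxm).natDegree_mul hEm, hxm.natDegree_mul hxm]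
      obtain ⟨A, B, hA, hB, hBs, hAB⟩ := ih E.natDegree (by omega) hEm rfl
      exact ⟨normalize x * A, B, hxm.mul hA, hB, hBs, by rw [hE, hAB]; ring⟩

omit [Fintype F] in
theorem eq_of_sq_mul_squarefree_eq {A A' B B' : F[X]} (hA : A.Monic) (hA' : A'.Monic)
    (hB : Squarefree B) (hB' : Squarefree B') (h : A ^ 2 * B = A' ^ 2 * B') : A = A' := by
  classical
  have key : ∀ {A A' B B' : F[X]}, A ≠ 0 → Squarefree B' → A ^ 2 * B = A' ^ 2 * B' → A ∣ A' := by
    intro A A' B B' hA hB' h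
    obtain ⟨a, ha⟩ := EuclideanDomain.gcd_dvd_left A A'
    obtain ⟨a', ha'⟩ := EuclideanDomain.gcd_dvd_right A A'
    set d := EuclideanDomain.gcd A A' with hd
    have hd0 : d ≠ 0 := fun h0 => hA (by rw [ha, h0, zero_mul])
    have hcop : IsCoprime a a' := by
      have h1 := EuclideanDomain.gcd_eq_gcd_ab A A'
      refine ⟨EuclideanDomain.gcdA A A', EuclideanDomain.gcdB A A', ?_⟩
      apply mul_left_cancel₀ hd0
      calc d * (EuclideanDomain.gcdA A A' * a + EuclideanDomain.gcdB A A' * a')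
          = (d * a) * EuclideanDomain.gcdA A A' + (d * a') * EuclideanDomain.gcdB A A' := by ring
        _ = d * 1 := by rw [← ha, ← ha', ← h1, mul_one]
    have h2 : a ^ 2 * B = a' ^ 2 * B' := by
      apply mul_left_cancel₀ (pow_ne_zero 2 hd0)
      calc d ^ 2 * (a ^ 2 * B) = (d * a) ^ 2 * B := by ring
        _ = (d * a') ^ 2 * B' := by rw [← ha, ← ha', h]
        _ = d ^ 2 * (a' ^ 2 * B') := by ring
    have h3 : a ^ 2 ∣ B' := (hcop.pow (m := 2) (n := 2)).dvd_of_dvd_mul_left (Dvd.intro _ h2)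
    have hu : IsUnit a := hB' a (by rwa [← sq])
    rw [ha]
    exact (hu.mul_right_dvd.2 (Dvd.intro _ ha'.symm))
  exact eq_of_monic_of_associated hA hA' (associated_of_dvd_dvd (key hA.ne_zero hB' h)
    (key hA'.ne_zero hB h.symm))

theorem card_pow_eq_sum_card_ensemble (n : ℕ) : Fintype.card F ^ n =
    ∑ a ∈ Finset.range (n / 2 + 1), Fintype.card F ^ a * (ensemble F (n - 2 * a)).card := by
  rw [← card_monics]
  have h1 : ∑ a ∈ Finset.range (n / 2 + 1), Fintype.card F ^ a * (ensemble F (n - 2 * a)).card =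
      ((Finset.range (n / 2 + 1)).sigma
        fun a => monics F a ×ˢ ensemble F (n - 2 * a)).card := by
    rw [Finset.card_sigma]
    exact Finset.sum_congr rfl fun a _ => by rw [Finset.card_product, card_monics]
  rw [h1]
  refine (Finset.card_bij (fun p _ => p.2.1 ^ 2 * p.2.2) ?_ ?_ ?_).symm
  · rintro ⟨a, A, B⟩ hp
    simp only [Finset.mem_sigma, Finset.mem_product, Finset.mem_range, mem_monics,
      mem_ensemble] at hp
    obtain ⟨ha, ⟨hA, hAd⟩, hB, hBd, -⟩ := hp
    rw [mem_monics]
    refine ⟨(hA.pow 2).mul hB, ?_⟩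
    rw [(hA.pow 2).natDegree_mul hB, hA.natDegree_pow, hAd, hBd]
    omega
  · rintro ⟨a, A, B⟩ hp ⟨a', A', B'⟩ hp' h
    simp only [Finset.mem_sigma, Finset.mem_product, Finset.mem_range, mem_monics,
      mem_ensemble] at hp hp'
    obtain ⟨-, ⟨hA, hAd⟩, hB, hBd, hBs⟩ := hp
    obtain ⟨-, ⟨hA', hAd'⟩, hB', hBd', hBs'⟩ := hp'
    obtain rfl := eq_of_sq_mul_squarefree_eq hA hA' hBs hBs' h
    obtain rfl := mul_left_cancel₀ (pow_ne_zero 2 hA.ne_zero) h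
    obtain rfl : a = a' := hAd.symm.trans hAd'
    rfl
  · intro f hf
    obtain ⟨hm, hd⟩ := mem_monics.1 hf
    obtain ⟨A, B, hA, hB, hBs, rfl⟩ := exists_sq_mul_squarefree hm
    rw [(hA.pow 2).natDegree_mul hB, hA.natDegree_pow] at hd
    refine ⟨⟨A.natDegree, A, B⟩, ?_, rfl⟩
    simp only [Finset.mem_sigma, Finset.mem_product, Finset.mem_range, mem_monics, mem_ensemble]
    exact ⟨by omega, ⟨hA, trivial⟩, hB, by omega, hBs⟩

theorem card_ensemble_add_two (n : ℕ) :
    (ensemble F (n + 2)).card + Fintype.card F ^ (n + 1) = Fintype.card F ^ (n + 2) := by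
  rw [card_pow_eq_sum_card_ensemble (n + 2), Finset.sum_range_succ', add_comm, pow_succ',
    card_pow_eq_sum_card_ensemble n, Finset.mul_sum, show (n + 2) / 2 = n / 2 + 1 by omega]
  congr 1
  · refine Finset.sum_congr rfl fun a _ => ?_
    rw [pow_succ', mul_assoc, show n + 2 - 2 * (a + 1) = n - 2 * a by omega]
  · simp

theorem card_ensemble_le (n : ℕ) : (ensemble F n).card ≤ Fintype.card F ^ n := by
  rw [← card_monics]
  exact Finset.card_le_card (ensemble_subset_monics n)

theorem pow_le_two_mul_card_ensemble (n : ℕ) :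
    Fintype.card F ^ n ≤ 2 * (ensemble F n).card := by
  have h2 : 2 ≤ Fintype.card F := Fintype.one_lt_card
  rcases Nat.lt_or_ge n 2 with hn | hn
  · have h := card_pow_eq_sum_card_ensemble (F := F) n
    rw [show n / 2 + 1 = 1 by omega] at h
    simp at h
    omega
  · obtain ⟨k, rfl⟩ := Nat.exists_eq_add_of_le' hn
    have h := card_ensemble_add_two (F := F) k
    have h3 : 2 * Fintype.card F ^ (k + 1) ≤ Fintype.card F ^ (k + 2) := by
      rw [pow_succ' _ (k + 1)]
      exact Nat.mul_le_mul_right _ h2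
    omega

/-! ### Densities of divisibility conditions among square-free polynomials -/

theorem polyNorm_of_ne_zero {f : F[X]} (hf : f ≠ 0) :
    polyNorm f = (Fintype.card F : ℝ) ^ f.natDegree := if_neg hf

theorem polyNorm_prime (P : MonicIrreducible F) :
    polyNorm P.1 = (Fintype.card F : ℝ) ^ P.1.natDegree := polyNorm_of_ne_zero P.2.1.ne_zero

theorem one_lt_card_real (F : Type*) [Field F] [Fintype F] : (1 : ℝ) < Fintype.card F := by
  exact_mod_cast Fintype.one_lt_card

theorem two_le_polyNorm_prime (P : MonicIrreducible F) : 2 ≤ polyNorm P.1 := by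
  rw [polyNorm_prime]
  have h2 : 2 ≤ Fintype.card F := Fintype.one_lt_card
  have h : Fintype.card F ^ 1 ≤ Fintype.card F ^ P.1.natDegree :=
    Nat.pow_le_pow_right (by omega) P.2.2.natDegree_pos
  have : 2 ≤ Fintype.card F ^ P.1.natDegree := by rw [pow_one] at h; omega
  exact_mod_cast this

theorem polyNorm_prime_pos (P : MonicIrreducible F) : 0 < polyNorm P.1 :=
  zero_lt_two.trans_le (two_le_polyNorm_prime P)

open scoped Classical in
/-- The members of the ensemble divisible by all the primes of a finite set. -/
def divisibleEnsemble (s : Finset (MonicIrreducible F)) (n : ℕ) : Finset F[X] :=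
  {D ∈ ensemble F n | ∀ P ∈ s, P.1 ∣ D}

theorem mem_divisibleEnsemble {s : Finset (MonicIrreducible F)} {n : ℕ} {D : F[X]} :
    D ∈ divisibleEnsemble s n ↔ D ∈ ensemble F n ∧ ∀ P ∈ s, P.1 ∣ D := by
  classical
  rw [divisibleEnsemble, Finset.mem_filter]

omit [Fintype F] in
theorem isCoprime_of_ne {P Q : MonicIrreducible F} (h : P ≠ Q) : IsCoprime P.1 Q.1 := by
  rw [P.2.2.coprime_iff_not_dvd]
  intro hdvd
  exact h (Subtype.ext (eq_of_monic_of_associated P.2.1 Q.2.1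
    (P.2.2.associated_of_dvd Q.2.2 hdvd)))

open scoped Classical in
/-- Cancelling a prime `P` from a square-free multiple of `P` leaves a square-free polynomial not
divisible by `P`. -/
theorem card_divisibleEnsemble_insert {s : Finset (MonicIrreducible F)} {P : MonicIrreducible F}
    (hP : P ∉ s) (n : ℕ) :
    (divisibleEnsemble (insert P s) (n + P.1.natDegree)).card +
      (divisibleEnsemble (insert P s) n).card = (divisibleEnsemble s n).card := by
  have h1 : (divisibleEnsemble (insert P s) (n + P.1.natDegree)).card =
      {B ∈ divisibleEnsemble s n | ¬ P.1 ∣ B}.card := by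
    refine (Finset.card_bij (fun B _ => P.1 * B) ?_ ?_ ?_).symm
    · intro B hB
      rw [Finset.mem_filter, mem_divisibleEnsemble, mem_ensemble] at hB
      obtain ⟨⟨⟨hm, hd, hsq⟩, hs⟩, hPB⟩ := hB
      rw [mem_divisibleEnsemble, mem_ensemble]
      refine ⟨⟨P.2.1.mul hm, by rw [P.2.1.natDegree_mul hm, hd, add_comm], ?_⟩, ?_⟩
      · exact (squarefree_mul_iff).2 ⟨((P.2.2.coprime_iff_not_dvd).2 hPB).isRelPrime,
          P.2.2.squarefree, hsq⟩
      · intro Q hQ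
        rcases Finset.mem_insert.1 hQ with rfl | hQ
        · exact dvd_mul_right _ _
        · exact (hs Q hQ).mul_left _
    · intro a _ b _ h
      exact mul_left_cancel₀ P.2.1.ne_zero h
    · intro D hD
      rw [mem_divisibleEnsemble, mem_ensemble] at hD
      obtain ⟨⟨hm, hd, hsq⟩, hs⟩ := hD
      obtain ⟨B, rfl⟩ := hs P (Finset.mem_insert_self _ _)
      have hB := P.2.1.of_mul_monic_left hm
      rw [P.2.1.natDegree_mul hB] at hd
      refine ⟨B, ?_, rfl⟩
      rw [Finset.mem_filter, mem_divisibleEnsemble, mem_ensemble]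
      refine ⟨⟨⟨hB, by omega, hsq.squarefree_of_dvd (dvd_mul_left _ _)⟩, fun Q hQ => ?_⟩, ?_⟩
      · have hne : Q ≠ P := fun h => hP (h ▸ hQ)
        exact (isCoprime_of_ne hne).dvd_of_dvd_mul_left (hs Q (Finset.mem_insert_of_mem hQ))
      · rintro ⟨E, rfl⟩
        exact P.2.2.not_isUnit (hsq P.1 ⟨E, by ring⟩)
  have h2 : divisibleEnsemble (insert P s) n = {B ∈ divisibleEnsemble s n | P.1 ∣ B} := by
    ext D
    rw [Finset.mem_filter, mem_divisibleEnsemble, mem_divisibleEnsemble, Finset.forall_mem_insert]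
    tauto
  rw [h1, h2, add_comm, Finset.card_filter_add_card_filter_not]

/-- A sequence with `e (n + d) = c * (δ n - e n)`, where `|c| < 1` and `δ` tends to zero, tends to
zero if it is bounded. -/
theorem tendsto_zero_of_recursion {e δ : ℕ → ℝ} {c B : ℝ} (hc0 : 0 ≤ c) (hc1 : c < 1) {d : ℕ}
    (hB : ∀ n, |e n| ≤ B) (hδ : Tendsto δ atTop (nhds 0))
    (hrec : ∀ n, e (n + d) = c * (δ n - e n)) : Tendsto e atTop (nhds 0) := by
  rw [Metric.tendsto_atTop]
  intro ε hε
  have hη : 0 < (1 - c) * (ε / 2) := mul_pos (by linarith) (by linarith)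
  obtain ⟨N₀, hN₀⟩ := Metric.tendsto_atTop.1 hδ _ hη
  have hiter : ∀ k, ∀ n ≥ N₀ + k * d, |e n| ≤ c ^ k * B + ε / 2 := by
    intro k
    induction k with
    | zero => intro n _; rw [pow_zero, one_mul]; linarith [hB n]
    | succ k ih =>
      intro n hn
      obtain ⟨m, rfl⟩ : ∃ m, n = m + d := ⟨n - d, by rw [Nat.succ_mul] at hn; omega⟩
      have hm : m ≥ N₀ + k * d := by rw [Nat.succ_mul] at hn; omega
      have h1 := ih m hm
      have h2 := hN₀ m (le_trans (Nat.le_add_right _ _) hm)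
      rw [Real.dist_eq, sub_zero] at h2
      rw [hrec, abs_mul, abs_of_nonneg hc0]
      have h3 : |δ m - e m| ≤ (1 - c) * (ε / 2) + (c ^ k * B + ε / 2) :=
        (abs_sub _ _).trans (add_le_add h2.le h1)
      calc c * |δ m - e m| ≤ c * ((1 - c) * (ε / 2) + (c ^ k * B + ε / 2)) :=
            mul_le_mul_of_nonneg_left h3 hc0
        _ ≤ c ^ (k + 1) * B + ε / 2 := by
            rw [pow_succ']
            nlinarith [mul_nonneg hε.le (sq_nonneg (1 - c))]
  have hpow : Tendsto (fun k => c ^ k * B) atTop (nhds 0) := by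
    simpa using (tendsto_pow_atTop_nhds_zero_of_lt_one hc0 hc1).mul_const B
  obtain ⟨k, hk⟩ := (hpow.eventually (gt_mem_nhds (half_pos hε))).exists
  refine ⟨N₀ + k * d, fun n hn => ?_⟩
  rw [Real.dist_eq, sub_zero]
  linarith [hiter k n hn]

theorem tendsto_card_ensemble_div :
    Tendsto (fun n => ((ensemble F n).card : ℝ) / (Fintype.card F : ℝ) ^ n) atTop
      (nhds (1 - 1 / (Fintype.card F : ℝ))) := by
  have hq : (0 : ℝ) < Fintype.card F := zero_lt_one.trans (one_lt_card_real F)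
  refine tendsto_const_nhds.congr' ?_
  filter_upwards [eventually_ge_atTop 2] with n hn
  obtain ⟨k, rfl⟩ := Nat.exists_eq_add_of_le' hn
  have h := congrArg (Nat.cast (R := ℝ)) (card_ensemble_add_two (F := F) k)
  push_cast at h
  rw [eq_sub_of_add_eq h]
  field_simp
  ring

theorem tendsto_card_divisibleEnsemble_div (s : Finset (MonicIrreducible F)) :
    Tendsto (fun n => ((divisibleEnsemble s n).card : ℝ) / (Fintype.card F : ℝ) ^ n) atTop
      (nhds ((1 - 1 / (Fintype.card F : ℝ)) * ∏ P ∈ s, 1 / (polyNorm P.1 + 1))) := by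
  classical
  have hq : (0 : ℝ) < Fintype.card F := zero_lt_one.trans (one_lt_card_real F)
  induction s using Finset.induction_on with
  | empty =>
    rw [Finset.prod_empty, mul_one]
    simpa [divisibleEnsemble] using tendsto_card_ensemble_div (F := F)
  | insert P s hP ih =>
    rw [Finset.prod_insert hP]
    set κ := (1 - 1 / (Fintype.card F : ℝ)) * ∏ P ∈ s, 1 / (polyNorm P.1 + 1) with hκ
    set L := (1 - 1 / (Fintype.card F : ℝ)) * (1 / (polyNorm P.1 + 1) *
      ∏ P ∈ s, 1 / (polyNorm P.1 + 1)) with hL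
    set x : ℕ → ℝ := fun n =>
      ((divisibleEnsemble (insert P s) n).card : ℝ) / (Fintype.card F : ℝ) ^ n with hx
    set y : ℕ → ℝ := fun n => ((divisibleEnsemble s n).card : ℝ) / (Fintype.card F : ℝ) ^ n with hy
    have hN := polyNorm_prime_pos P
    have hN2 := two_le_polyNorm_prime P
    have hLκ : L * (polyNorm P.1 + 1) = κ := by
      have h1 : 1 / (polyNorm P.1 + 1) * (polyNorm P.1 + 1) = 1 :=
        one_div_mul_cancel (by linarith)
      rw [hL, hκ]
      linear_combination (1 - 1 / (Fintype.card F : ℝ)) *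
        (∏ P ∈ s, 1 / (polyNorm P.1 + 1)) * h1
    have hx0 : ∀ n, 0 ≤ x n := fun n => by positivity
    have hx1 : ∀ n, x n ≤ 1 := fun n => by
      rw [hx]
      dsimp only
      rw [div_le_one (by positivity)]
      exact_mod_cast (Finset.card_filter_le _ _).trans (card_ensemble_le n)
    have hrec : ∀ n, x (n + P.1.natDegree) = (polyNorm P.1)⁻¹ * (y n - x n) := by
      intro n
      have h := congrArg (Nat.cast (R := ℝ)) (card_divisibleEnsemble_insert hP n)
      push_cast at h
      simp only [hx, hy]
      rw [polyNorm_prime, ← h, pow_add]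
      field_simp
      ring
    have he : Tendsto (fun n => x n - L) atTop (nhds 0) := by
      refine tendsto_zero_of_recursion (δ := fun n => y n - κ) (c := (polyNorm P.1)⁻¹)
        (B := 1 + |L|) (d := P.1.natDegree) (by positivity) (inv_lt_one_of_one_lt₀ (by linarith))
        (fun n => ?_) ?_ (fun n => ?_)
      · refine (abs_sub _ _).trans (add_le_add ?_ le_rfl)
        rw [abs_of_nonneg (hx0 n)]
        exact hx1 n
      · simpa using ih.sub_const κ
      · rw [hrec, ← hLκ]
        field_simp
        ring
    simpa using he.add_const L

theorem tendsto_card_divisibleEnsemble_div_card (s : Finset (MonicIrreducible F)) :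
    Tendsto (fun n => ((divisibleEnsemble s n).card : ℝ) / (ensemble F n).card) atTop
      (nhds (∏ P ∈ s, 1 / (polyNorm P.1 + 1))) := by
  have hq := one_lt_card_real F
  have hne : 1 - 1 / (Fintype.card F : ℝ) ≠ 0 := by
    have : 1 / (Fintype.card F : ℝ) < 1 := by rw [div_lt_one (by linarith)]; exact hq
    linarith
  have h := (tendsto_card_divisibleEnsemble_div s).div tendsto_card_ensemble_div hne
  rw [mul_div_cancel_left₀ _ hne] at h
  refine h.congr fun n => ?_
  have : (0 : ℝ) < (Fintype.card F : ℝ) ^ n := by positivity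
  simp only [Pi.div_apply]
  rw [div_div_div_cancel_right₀ this.ne']

/-! ### The arithmetic factor -/

theorem summable_one_div_polyNorm_sq :
    Summable fun P : MonicIrreducible F => (polyNorm P.1 ^ 2)⁻¹ := by
  classical
  have hq := one_lt_card_real F
  have hr0 : (0 : ℝ) ≤ (Fintype.card F : ℝ)⁻¹ := by positivity
  have hr1 : (Fintype.card F : ℝ)⁻¹ < 1 := inv_lt_one_of_one_lt₀ hq
  refine summable_of_sum_le (c := (1 - (Fintype.card F : ℝ)⁻¹)⁻¹) (fun P => by positivity) ?_
  intro s
  set n := s.sup (fun P => P.1.natDegree) with hn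
  have h1 : ∀ k, ∑ P ∈ s with P.1.natDegree = k, (polyNorm P.1 ^ 2)⁻¹ ≤
      (Fintype.card F : ℝ)⁻¹ ^ k := by
    intro k
    have h2 : ∀ P ∈ s.filter (fun P => P.1.natDegree = k),
        (polyNorm P.1 ^ 2)⁻¹ = ((Fintype.card F : ℝ) ^ k * (Fintype.card F : ℝ) ^ k)⁻¹ := by
      intro P hP
      rw [polyNorm_prime, (Finset.mem_filter.1 hP).2, sq]
    have h3 : (s.filter (fun P => P.1.natDegree = k)).card ≤ Fintype.card F ^ k := by
      rw [← card_monics]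
      refine Finset.card_le_card_of_injOn (fun P => P.1) (fun P hP => ?_)
        (fun P _ Q _ h => Subtype.ext h)
      exact mem_monics.2 ⟨P.2.1, (Finset.mem_filter.1 hP).2⟩
    rw [Finset.sum_congr rfl h2, Finset.sum_const, nsmul_eq_mul]
    have h4 : ((s.filter (fun P => P.1.natDegree = k)).card : ℝ) ≤ (Fintype.card F : ℝ) ^ k := by
      exact_mod_cast h3
    have h5 : (0 : ℝ) < (Fintype.card F : ℝ) ^ k := by positivity
    calc _ ≤ (Fintype.card F : ℝ) ^ k * ((Fintype.card F : ℝ) ^ k * (Fintype.card F : ℝ) ^ k)⁻¹ :=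
          mul_le_mul_of_nonneg_right h4 (by positivity)
      _ = _ := by rw [inv_pow]; field_simp
  calc ∑ P ∈ s, (polyNorm P.1 ^ 2)⁻¹
      = ∑ k ∈ Finset.range (n + 1), ∑ P ∈ s with P.1.natDegree = k, (polyNorm P.1 ^ 2)⁻¹ := by
        refine (Finset.sum_fiberwise_of_maps_to (fun P hP => ?_) _).symm
        rw [Finset.mem_range, Nat.lt_succ_iff]
        exact Finset.le_sup (f := fun P : MonicIrreducible F => P.1.natDegree) hP
    _ ≤ ∑ k ∈ Finset.range (n + 1), (Fintype.card F : ℝ)⁻¹ ^ k := Finset.sum_le_sum fun k _ => h1 k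
    _ ≤ ∑' k, (Fintype.card F : ℝ)⁻¹ ^ k :=
        (summable_geometric_of_lt_one hr0 hr1).sum_le_tsum _ (fun k _ => by positivity)
    _ = _ := tsum_geometric_of_lt_one hr0 hr1

theorem eulerFactor_one (P : MonicIrreducible F) :
    eulerFactor 1 P = 1 + -(1 / (polyNorm P.1 * (polyNorm P.1 + 1))) := by
  rw [eulerFactor, Real.rpow_one, mul_comm (polyNorm P.1 + 1), sub_eq_add_neg]

theorem summable_norm_eulerFactor_sub_one :
    Summable fun P : MonicIrreducible F => ‖-(1 / (polyNorm P.1 * (polyNorm P.1 + 1)))‖ := by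
  refine summable_one_div_polyNorm_sq.of_nonneg_of_le (fun P => norm_nonneg _) (fun P => ?_)
  have h := polyNorm_prime_pos P
  rw [norm_neg, Real.norm_of_nonneg (by positivity), one_div]
  refine inv_anti₀ (by positivity) ?_
  nlinarith

theorem multipliable_eulerFactor : Multipliable (eulerFactor (F := F) 1) := by
  have := multipliable_one_add_of_summable (summable_norm_eulerFactor_sub_one (F := F))
  exact this.congr fun P => (eulerFactor_one P).symm

theorem arithFactor_one_ne_zero : arithFactor F 1 ≠ 0 := by
  rw [arithFactor, tprod_congr eulerFactor_one]
  refine tprod_one_add_ne_zero_of_summable (fun P => ?_) summable_norm_eulerFactor_sub_one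
  have h := two_le_polyNorm_prime P
  have h1 : 1 / (polyNorm P.1 * (polyNorm P.1 + 1)) < 1 := by
    rw [div_lt_one (by positivity)]
    nlinarith
  linarith

theorem arithFactor_one_eq_tsum : arithFactor F 1 =
    ∑' s : Finset (MonicIrreducible F), ∏ P ∈ s, -(1 / (polyNorm P.1 * (polyNorm P.1 + 1))) := by
  rw [arithFactor, tprod_congr eulerFactor_one]
  exact tprod_one_add (summable_finsetProd_of_summable_norm summable_norm_eulerFactor_sub_one)

/-! ### Coprime pairs -/

open scoped Classical in
/-- The number of pairs of a monic `l` of degree `m` and a monic square-free `D` of degree `n`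
which are coprime. -/
def coprimePairs (F : Type*) [Field F] [Fintype F] (m n : ℕ) : ℕ :=
  ∑ l ∈ monics F m, {D ∈ ensemble F n | IsCoprime D l}.card

theorem coprimePairs_le (m n : ℕ) :
    coprimePairs F m n ≤ Fintype.card F ^ m * (ensemble F n).card := by
  classical
  rw [coprimePairs, ← card_monics, ← smul_eq_mul, ← Finset.sum_const]
  exact Finset.sum_le_sum fun l _ => Finset.card_filter_le _ _

open scoped Classical in
/-- The monic irreducible polynomials of degree at most `n`, as a set of primes. -/
def primeSet (F : Type*) [Field F] [Fintype F] (n : ℕ) : Finset (MonicIrreducible F) :=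
  Finset.subtype _ (primes F n)

theorem mem_primeSet {n : ℕ} {P : MonicIrreducible F} : P ∈ primeSet F n ↔ P.1.natDegree ≤ n := by
  classical
  rw [primeSet, Finset.mem_subtype, mem_primes]
  exact ⟨fun h => h.2.2, fun h => ⟨P.2.1, P.2.2, h⟩⟩

omit [Fintype F] in
theorem monic_prod (s : Finset (MonicIrreducible F)) : (∏ P ∈ s, P.1).Monic :=
  monic_prod_of_monic _ _ fun P _ => P.2.1

omit [Fintype F] in
theorem prod_dvd_iff (s : Finset (MonicIrreducible F)) (f : F[X]) :
    ∏ P ∈ s, P.1 ∣ f ↔ ∀ P ∈ s, P.1 ∣ f :=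
  ⟨fun h _ hP => (Finset.dvd_prod_of_mem _ hP).trans h,
    fun h => Finset.prod_dvd_of_coprime (fun _ _ _ _ hne => isCoprime_of_ne hne) h⟩

open scoped Classical in
theorem isCoprime_iff_filter_eq_empty {D l : F[X]} {m : ℕ} (hl : l ∈ monics F m) :
    IsCoprime D l ↔ {P ∈ primeSet F m | P.1 ∣ l ∧ P.1 ∣ D} = ∅ := by
  obtain ⟨hm, hd⟩ := mem_monics.1 hl
  rw [Finset.filter_eq_empty_iff]
  constructor
  · rintro h P - ⟨h1, h2⟩
    exact P.2.2.not_isUnit (h.isUnit_of_dvd' h2 h1)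
  · intro h
    refine isCoprime_of_irreducible_dvd (fun h0 => hm.ne_zero h0.2) fun z hz hzD hzl => ?_
    have hn := monic_normalize hz.ne_zero
    have hassoc := normalize_associated z
    have hdl : normalize z ∣ l := hassoc.dvd.trans hzl
    refine h (x := ⟨normalize z, hn, hassoc.symm.irreducible hz⟩) ?_ ⟨hdl, hassoc.dvd.trans hzD⟩
    exact mem_primeSet.2 (hd ▸ natDegree_le_of_dvd hdl hm.ne_zero)

open scoped Classical in
/-- Inclusion and exclusion over the common prime divisors. -/
theorem coprimePairs_eq_sum (m n : ℕ) : (coprimePairs F m n : ℤ) =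
    ∑ s ∈ (primeSet F m).powerset, (-1 : ℤ) ^ s.card *
      ({l ∈ monics F m | ∏ P ∈ s, P.1 ∣ l}.card * (divisibleEnsemble s n).card) := by
  have h1 : ∀ l ∈ monics F m, ∀ D ∈ ensemble F n, (if IsCoprime D l then (1 : ℤ) else 0) =
      ∑ s ∈ (primeSet F m).powerset,
        if (∏ P ∈ s, P.1 ∣ l) ∧ ∀ P ∈ s, P.1 ∣ D then (-1) ^ s.card else 0 := by
    intro l hl D _
    rw [← Finset.sum_filter]
    have h2 : {s ∈ (primeSet F m).powerset | (∏ P ∈ s, P.1 ∣ l) ∧ ∀ P ∈ s, P.1 ∣ D} =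
        ({P ∈ primeSet F m | P.1 ∣ l ∧ P.1 ∣ D} : Finset (MonicIrreducible F)).powerset := by
      ext s
      rw [Finset.mem_filter, Finset.mem_powerset, Finset.mem_powerset, prod_dvd_iff]
      constructor
      · rintro ⟨hs, hsl, hsD⟩ P hP
        exact Finset.mem_filter.2 ⟨hs hP, hsl P hP, hsD P hP⟩
      · intro h
        exact ⟨fun P hP => (Finset.mem_filter.1 (h hP)).1,
          fun P hP => (Finset.mem_filter.1 (h hP)).2.1,
          fun P hP => (Finset.mem_filter.1 (h hP)).2.2⟩
    rw [h2, Finset.sum_powerset_neg_one_pow_card]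
    exact if_congr (isCoprime_iff_filter_eq_empty hl) rfl rfl
  have h3 : (coprimePairs F m n : ℤ) =
      ∑ l ∈ monics F m, ∑ D ∈ ensemble F n, if IsCoprime D l then (1 : ℤ) else 0 := by
    rw [coprimePairs]
    push_cast
    refine Finset.sum_congr rfl fun l _ => ?_
    rw [Finset.card_filter]
    push_cast
    rfl
  rw [h3, Finset.sum_congr rfl fun l hl => Finset.sum_congr rfl (h1 l hl)]
  have h4 : ∀ l ∈ monics F m, ∑ D ∈ ensemble F n, ∑ s ∈ (primeSet F m).powerset,
      (if (∏ P ∈ s, P.1 ∣ l) ∧ ∀ P ∈ s, P.1 ∣ D then (-1 : ℤ) ^ s.card else 0) =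
      ∑ s ∈ (primeSet F m).powerset, ∑ D ∈ ensemble F n,
      (if (∏ P ∈ s, P.1 ∣ l) ∧ ∀ P ∈ s, P.1 ∣ D then (-1 : ℤ) ^ s.card else 0) :=
    fun l _ => Finset.sum_comm
  rw [Finset.sum_congr rfl h4, Finset.sum_comm]
  refine Finset.sum_congr rfl fun s _ => ?_
  rw [divisibleEnsemble, Finset.card_filter, Finset.card_filter]
  push_cast
  rw [Finset.sum_mul_sum, Finset.mul_sum]
  refine Finset.sum_congr rfl fun l _ => ?_
  rw [Finset.mul_sum]
  refine Finset.sum_congr rfl fun D _ => ?_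
  by_cases ha : ∏ P ∈ s, P.1 ∣ l
  · simp [ha]
  · simp [ha]

omit [Fintype F] in
theorem natDegree_prod_primes (s : Finset (MonicIrreducible F)) :
    (∏ P ∈ s, P.1).natDegree = ∑ P ∈ s, P.1.natDegree :=
  natDegree_prod_of_monic _ _ fun P _ => P.2.1

theorem prod_polyNorm (s : Finset (MonicIrreducible F)) :
    ∏ P ∈ s, polyNorm P.1 = (Fintype.card F : ℝ) ^ (∏ P ∈ s, P.1).natDegree := by
  rw [natDegree_prod_primes, ← Finset.prod_pow_eq_pow_sum]
  exact Finset.prod_congr rfl fun P _ => polyNorm_prime P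

open scoped Classical in
/-- The term of `s` in the inclusion-exclusion sum for the proportion of coprime pairs. -/
def coprimeTerm (s : Finset (MonicIrreducible F)) (p : ℕ × ℕ) : ℝ :=
  (-1) ^ s.card * ((({l ∈ monics F p.1 | ∏ P ∈ s, P.1 ∣ l}.card : ℕ) : ℝ) /
    (Fintype.card F : ℝ) ^ p.1 * (((divisibleEnsemble s p.2).card : ℝ) / (ensemble F p.2).card))

theorem card_monics_prod_dvd_div (s : Finset (MonicIrreducible F)) (m : ℕ)
    [DecidablePred fun l : F[X] => ∏ P ∈ s, P.1 ∣ l] :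
    ((({l ∈ monics F m | ∏ P ∈ s, P.1 ∣ l}.card : ℕ) : ℝ) / (Fintype.card F : ℝ) ^ m) =
      if (∏ P ∈ s, P.1).natDegree ≤ m then ∏ P ∈ s, 1 / polyNorm P.1 else 0 := by
  rw [card_monics_dvd (monic_prod s)]
  split_ifs with h
  · rw [Finset.prod_div_distrib, prod_polyNorm, Finset.prod_const_one]
    have hq : (0 : ℝ) < Fintype.card F := zero_lt_one.trans (one_lt_card_real F)
    push_cast
    rw [div_eq_div_iff (by positivity) (by positivity), ← pow_add, one_mul, Nat.sub_add_cancel h]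
  · rw [Nat.cast_zero, zero_div]

theorem coprimePairs_div_eq_tsum (m n : ℕ) :
    (coprimePairs F m n : ℝ) / ((Fintype.card F : ℝ) ^ m * (ensemble F n).card) =
      ∑' s : Finset (MonicIrreducible F), coprimeTerm s (m, n) := by
  classical
  rw [tsum_eq_sum (s := (primeSet F m).powerset)]
  · have h := congrArg (Int.cast (R := ℝ)) (coprimePairs_eq_sum (F := F) m n)
    push_cast at h
    rw [h, Finset.sum_div]
    refine Finset.sum_congr rfl fun s _ => ?_
    rw [coprimeTerm, mul_div_assoc, mul_div_mul_comm]
  · intro s hs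
    rw [coprimeTerm, card_monics_prod_dvd_div, if_neg, zero_mul, mul_zero]
    intro h
    apply hs
    rw [Finset.mem_powerset]
    intro P hP
    rw [mem_primeSet]
    rw [natDegree_prod_primes] at h
    exact (Finset.single_le_sum (f := fun P : MonicIrreducible F => P.1.natDegree)
      (fun _ _ => Nat.zero_le _) hP).trans h

theorem card_divisibleEnsemble_div_le (s : Finset (MonicIrreducible F)) (n : ℕ) :
    ((divisibleEnsemble s n).card : ℝ) / (ensemble F n).card ≤ 2 * ∏ P ∈ s, 1 / polyNorm P.1 := by
  classical
  have hq : (0 : ℝ) < Fintype.card F := zero_lt_one.trans (one_lt_card_real F)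
  have h1 : ((divisibleEnsemble s n).card : ℝ) ≤
      (({l ∈ monics F n | ∏ P ∈ s, P.1 ∣ l}.card : ℕ) : ℝ) := by
    rw [Nat.cast_le]
    refine Finset.card_le_card fun D hD => ?_
    rw [mem_divisibleEnsemble] at hD
    exact Finset.mem_filter.2 ⟨ensemble_subset_monics n hD.1, (prod_dvd_iff s D).2 hD.2⟩
  have h2 : (Fintype.card F : ℝ) ^ n ≤ 2 * (ensemble F n).card := by
    exact_mod_cast pow_le_two_mul_card_ensemble n
  have h3 := card_monics_prod_dvd_div s n
  have hpos : (0 : ℝ) < (Fintype.card F : ℝ) ^ n := by positivity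
  have hE : (0 : ℝ) < (ensemble F n).card := by linarith
  have hnn : 0 ≤ ∏ P ∈ s, 1 / polyNorm P.1 :=
    Finset.prod_nonneg fun P _ => by have := polyNorm_prime_pos P; positivity
  have h4 : (({l ∈ monics F n | ∏ P ∈ s, P.1 ∣ l}.card : ℕ) : ℝ) ≤
      (∏ P ∈ s, 1 / polyNorm P.1) * (Fintype.card F : ℝ) ^ n := by
    rw [← div_le_iff₀ hpos, h3]
    split_ifs
    · exact le_rfl
    · exact hnn
  rw [div_le_iff₀ hE]
  calc _ ≤ (∏ P ∈ s, 1 / polyNorm P.1) * (Fintype.card F : ℝ) ^ n := h1.trans h4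
    _ ≤ (∏ P ∈ s, 1 / polyNorm P.1) * (2 * (ensemble F n).card) :=
        mul_le_mul_of_nonneg_left h2 hnn
    _ = _ := by ring

/-- The proportion of coprime pairs tends to `P(1)`, by dominated convergence in the
inclusion-exclusion sum. -/
theorem tendsto_coprimePairs :
    Tendsto (fun p : ℕ × ℕ => (coprimePairs F p.1 p.2 : ℝ) /
      ((Fintype.card F : ℝ) ^ p.1 * (ensemble F p.2).card)) atTop (nhds (arithFactor F 1)) := by
  classical
  rw [arithFactor_one_eq_tsum]
  simp only [coprimePairs_div_eq_tsum]
  have hsum : Summable fun s : Finset (MonicIrreducible F) =>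
      2 * ∏ P ∈ s, (polyNorm P.1 ^ 2)⁻¹ := by
    have h : Summable fun P : MonicIrreducible F => ‖(polyNorm P.1 ^ 2)⁻¹‖ :=
      summable_one_div_polyNorm_sq.norm
    have h1 : Summable fun s : Finset (MonicIrreducible F) => ∏ P ∈ s, (polyNorm P.1 ^ 2)⁻¹ :=
      summable_finsetProd_of_summable_norm h
    exact h1.mul_left 2
  refine tendsto_tsum_of_dominated_convergence hsum (fun s => ?_)
    (Eventually.of_forall fun p s => ?_)
  · have h1 : Tendsto (fun p : ℕ × ℕ => (({l ∈ monics F p.1 | ∏ P ∈ s, P.1 ∣ l}.card : ℕ) : ℝ) /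
        (Fintype.card F : ℝ) ^ p.1) atTop (nhds (∏ P ∈ s, 1 / polyNorm P.1)) := by
      refine tendsto_const_nhds.congr' ?_
      have hfst : Tendsto (Prod.fst : ℕ × ℕ → ℕ) atTop atTop := by
        rw [← prod_atTop_atTop_eq]
        exact tendsto_fst
      filter_upwards [hfst.eventually_ge_atTop (∏ P ∈ s, P.1).natDegree] with p hp
      rw [card_monics_prod_dvd_div, if_pos hp]
    have h2 : Tendsto (fun p : ℕ × ℕ => ((divisibleEnsemble s p.2).card : ℝ) /
        (ensemble F p.2).card) atTop (nhds (∏ P ∈ s, 1 / (polyNorm P.1 + 1))) := by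
      rw [← prod_atTop_atTop_eq]
      exact (tendsto_card_divisibleEnsemble_div_card s).comp tendsto_snd
    have h3 := (h1.mul h2).const_mul ((-1 : ℝ) ^ s.card)
    have h4 : (-1 : ℝ) ^ s.card * ((∏ P ∈ s, 1 / polyNorm P.1) *
        ∏ P ∈ s, 1 / (polyNorm P.1 + 1)) =
        ∏ P ∈ s, -(1 / (polyNorm P.1 * (polyNorm P.1 + 1))) := by
      rw [← Finset.prod_mul_distrib, ← Finset.prod_const, ← Finset.prod_mul_distrib]
      refine Finset.prod_congr rfl fun P _ => ?_
      rw [one_div_mul_one_div, neg_one_mul]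
    rw [← h4]
    exact h3
  · have hnn : 0 ≤ ∏ P ∈ s, 1 / polyNorm P.1 :=
      Finset.prod_nonneg fun P _ => by have := polyNorm_prime_pos P; positivity
    have h1 : ((({l ∈ monics F p.1 | ∏ P ∈ s, P.1 ∣ l}.card : ℕ) : ℝ) /
        (Fintype.card F : ℝ) ^ p.1) ≤ ∏ P ∈ s, 1 / polyNorm P.1 := by
      rw [card_monics_prod_dvd_div]
      split_ifs
      · exact le_rfl
      · exact hnn
    rw [coprimeTerm, norm_mul, norm_pow, norm_neg, norm_one, one_pow, one_mul,
      Real.norm_of_nonneg (by positivity)]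
    calc _ ≤ (∏ P ∈ s, 1 / polyNorm P.1) * (2 * ∏ P ∈ s, 1 / polyNorm P.1) :=
          mul_le_mul h1 (card_divisibleEnsemble_div_le s p.2) (by positivity) hnn
      _ = 2 * ((∏ P ∈ s, 1 / polyNorm P.1) * ∏ P ∈ s, 1 / polyNorm P.1) := by ring
      _ = _ := by
          rw [← Finset.prod_mul_distrib]
          congr 1
          refine Finset.prod_congr rfl fun P _ => ?_
          rw [one_div_mul_one_div, one_div, sq]

/-! ### Character sums over square-free polynomials -/

theorem exists_symbol_eq_neg_one (hF : ringChar F ≠ 2) {f : F[X]} (hf : f.Monic)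
    (hns : ∀ l : F[X], l.Monic → f ≠ l ^ 2) : ∃ x, symbol f x = -1 := by
  obtain ⟨A, B, hA, hB, hBs, rfl⟩ := exists_sq_mul_squarefree hf
  have hB1 : B ≠ 1 := by
    rintro rfl
    exact hns A hA (mul_one _)
  obtain ⟨P, E, hP, hirr, hE, rfl⟩ := exists_monic_irreducible_mul hB hB1
  have hPE : IsCoprime P E := by
    rw [hirr.coprime_iff_not_dvd]
    rintro ⟨G, rfl⟩
    exact hirr.not_isUnit (hBs P ⟨G, by ring⟩)
  obtain ⟨k, A', hPA', hAA'⟩ : ∃ (k : ℕ) (A' : F[X]), ¬ P ∣ A' ∧ A = P ^ k * A' := by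
    obtain ⟨A', h1, h2⟩ := (FiniteMultiplicity.of_not_isUnit hirr.not_isUnit
      hA.ne_zero).exists_eq_pow_mul_and_not_dvd
    exact ⟨_, A', h2, h1⟩
  have hA' : A'.Monic := (hP.pow k).of_mul_monic_left (hAA' ▸ hA)
  set m := A' ^ 2 * E with hm
  have hmm : m.Monic := (hA'.pow 2).mul hE
  have hcop : IsCoprime P m :=
    IsCoprime.mul_right (((hirr.coprime_iff_not_dvd).2 hPA').pow_right) hPE
  obtain ⟨u, v, huv⟩ := hcop
  obtain ⟨c, hc⟩ := exists_symbol_eq_neg_one_of_irreducible hF hP hirr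
  -- The Chinese remainder theorem: `x ≡ c` modulo `P`, and `x ≡ 1` modulo the prime-to-`P` part.
  refine ⟨u * P + c * (v * m), ?_⟩
  have h1 : symbol P (u * P + c * (v * m)) = -1 := by
    rw [← hc, ← symbol_add_mul hP c (u * (1 - c))]
    congr 1
    linear_combination c * huv
  have h2 : symbol m (u * P + c * (v * m)) = 1 := by
    rw [← symbol_one_right m, ← symbol_add_mul hmm 1 (v * (c - 1))]
    congr 1
    linear_combination huv
  have h3 : A ^ 2 * (P * E) = P ^ (2 * k + 1) * m := by
    rw [hAA', hm]
    ring
  have h4 : ∀ (j : ℕ) (y : F[X]), symbol (P ^ j) y = symbol P y ^ j := by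
    intro j y
    induction j with
    | zero => simp
    | succ j ih => rw [pow_succ, symbol_mul_left (hP.pow j) hP, ih, pow_succ]
  rw [h3, symbol_mul_left (hP.pow _) hmm, h4, h1, h2, mul_one, Odd.neg_one_pow ⟨k, rfl⟩]

theorem sum_monics_symbol_eq_zero (hF : ringChar F ≠ 2) {f : F[X]} (hf : f.Monic)
    (hns : ∀ l : F[X], l.Monic → f ≠ l ^ 2) {n : ℕ} (hn : f.natDegree ≤ n) :
    ∑ B ∈ monics F n, symbol f B = 0 := by
  obtain ⟨x, hx⟩ := exists_symbol_eq_neg_one hF hf hns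
  rw [sum_monics_periodic hf hn _ (symbol_add_mul hf), sum_symbol_eq_zero_of_neg_one hf hx,
    smul_zero]

omit [Fintype F] in
theorem sq_prod_dvd_iff (s : Finset (MonicIrreducible F)) (f : F[X]) :
    (∏ P ∈ s, P.1) ^ 2 ∣ f ↔ ∀ P ∈ s, P.1 ^ 2 ∣ f := by
  rw [← Finset.prod_pow]
  exact ⟨fun h _ hP => (Finset.dvd_prod_of_mem (fun P : MonicIrreducible F => P.1 ^ 2) hP).trans h,
    fun h => Finset.prod_dvd_of_coprime (fun _ _ _ _ hne => (isCoprime_of_ne hne).pow) h⟩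

open scoped Classical in
theorem squarefree_iff_filter_eq_empty {D : F[X]} {n : ℕ} (hD : D ∈ monics F n) :
    Squarefree D ↔ {P ∈ primeSet F n | P.1 ^ 2 ∣ D} = ∅ := by
  obtain ⟨hm, hd⟩ := mem_monics.1 hD
  rw [Finset.filter_eq_empty_iff]
  constructor
  · intro h P _ hP
    exact P.2.2.not_isUnit (h P.1 (by rwa [← sq]))
  · intro h
    by_contra hns
    rw [squarefree_iff_irreducible_sq_not_dvd_of_ne_zero hm.ne_zero] at hns
    push Not at hns
    obtain ⟨z, hz, hzD⟩ := hns
    have hassoc := normalize_associated z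
    have hdvd : normalize z ^ 2 ∣ D := by
      rw [sq]
      exact (hassoc.mul_mul hassoc).dvd.trans hzD
    refine h (x := ⟨normalize z, monic_normalize hz.ne_zero, hassoc.symm.irreducible hz⟩) ?_ hdvd
    exact mem_primeSet.2 (hd ▸ natDegree_le_of_dvd ((dvd_pow_self _ two_ne_zero).trans hdvd)
      hm.ne_zero)

open scoped Classical in
/-- The sieve for square-free polynomials, applied to a symbol. -/
theorem sum_ensemble_symbol (f : F[X]) (hf : f.Monic) (N : ℕ) :
    ∑ D ∈ ensemble F N, symbol f D = ∑ s ∈ (primeSet F N).powerset, (-1 : ℤ) ^ s.card *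
      if 2 * (∏ P ∈ s, P.1).natDegree ≤ N then symbol f (∏ P ∈ s, P.1) ^ 2 *
        ∑ B ∈ monics F (N - 2 * (∏ P ∈ s, P.1).natDegree), symbol f B else 0 := by
  have h0 : ensemble F N = {D ∈ monics F N | Squarefree D} := by
    ext D
    rw [Finset.mem_filter, mem_ensemble, mem_monics, and_assoc]
  have h1 : ∀ D ∈ monics F N, (if Squarefree D then symbol f D else 0) =
      ∑ s ∈ (primeSet F N).powerset,
        if (∏ P ∈ s, P.1) ^ 2 ∣ D then (-1 : ℤ) ^ s.card * symbol f D else 0 := by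
    intro D hD
    rw [← Finset.sum_filter, ← Finset.sum_mul]
    have h2 : {s ∈ (primeSet F N).powerset | (∏ P ∈ s, P.1) ^ 2 ∣ D} =
        ({P ∈ primeSet F N | P.1 ^ 2 ∣ D} : Finset (MonicIrreducible F)).powerset := by
      ext s
      rw [Finset.mem_filter, Finset.mem_powerset, Finset.mem_powerset, sq_prod_dvd_iff]
      constructor
      · rintro ⟨hs, hsD⟩ P hP
        exact Finset.mem_filter.2 ⟨hs hP, hsD P hP⟩
      · intro h
        exact ⟨fun P hP => (Finset.mem_filter.1 (h hP)).1,
          fun P hP => (Finset.mem_filter.1 (h hP)).2⟩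
    rw [h2, Finset.sum_powerset_neg_one_pow_card, ite_mul, one_mul, zero_mul]
    exact if_congr (squarefree_iff_filter_eq_empty hD) rfl rfl
  rw [h0, Finset.sum_filter, Finset.sum_congr rfl h1, Finset.sum_comm]
  refine Finset.sum_congr rfl fun s _ => ?_
  have hs := monic_prod s
  rw [← Finset.sum_filter, ← Finset.mul_sum, sum_monics_dvd (hs.pow 2), hs.natDegree_pow]
  congr 1
  refine if_congr Iff.rfl ?_ rfl
  rw [Finset.mul_sum]
  exact Finset.sum_congr rfl fun B _ => by rw [symbol_mul_right hf, symbol_pow_right hf]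

omit [Fintype F] in
theorem prod_primes_injective :
    Function.Injective fun s : Finset (MonicIrreducible F) => ∏ P ∈ s, P.1 := by
  intro s t hst
  have key : ∀ {s t : Finset (MonicIrreducible F)}, ∏ P ∈ s, P.1 = ∏ P ∈ t, P.1 → s ⊆ t := by
    intro s t h P hP
    have h1 : P.1 ∣ ∏ Q ∈ t, Q.1 := h ▸ Finset.dvd_prod_of_mem _ hP
    obtain ⟨Q, hQ, hPQ⟩ := (P.2.2.prime.dvd_finsetProd_iff _).1 h1
    by_cases hne : P = Q
    · exact hne ▸ hQ
    · exact absurd hPQ ((P.2.2.coprime_iff_not_dvd).1 (isCoprime_of_ne hne))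
  exact Finset.Subset.antisymm (key hst) (key hst.symm)

theorem sum_range_pow_le {q : ℕ} (hq : 2 ≤ q) (K : ℕ) :
    ∑ k ∈ Finset.range (K + 1), q ^ k ≤ 2 * q ^ K := by
  induction K with
  | zero => simp
  | succ K ih =>
    rw [Finset.sum_range_succ]
    have : 2 * q ^ K ≤ q ^ (K + 1) := by
      rw [pow_succ']
      exact Nat.mul_le_mul_right _ hq
    omega

/-- A non-square modulus has small character sums over square-free polynomials: in the sieve only
the large square divisors contribute, the others giving sums over complete residue systems. -/
theorem abs_sum_ensemble_symbol_le (hF : ringChar F ≠ 2) {f : F[X]} (hf : f.Monic)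
    (hns : ∀ l : F[X], l.Monic → f ≠ l ^ 2) (N : ℕ) :
    |∑ D ∈ ensemble F N, symbol f D| ≤
      2 * (Fintype.card F : ℤ) ^ ((N + f.natDegree - 1) / 2) := by
  classical
  set n := f.natDegree with hn
  set q := Fintype.card F with hq
  have hq2 : 2 ≤ q := Fintype.one_lt_card
  set a : Finset (MonicIrreducible F) → ℕ := fun s => (∏ P ∈ s, P.1).natDegree with ha
  have hterm : ∀ s : Finset (MonicIrreducible F), |(-1 : ℤ) ^ s.card *
      if 2 * a s ≤ N then symbol f (∏ P ∈ s, P.1) ^ 2 *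
        ∑ B ∈ monics F (N - 2 * a s), symbol f B else 0| ≤
      if 2 * a s ≤ N ∧ N < 2 * a s + n then (q : ℤ) ^ (N - 2 * a s) else 0 := by
    intro s
    rw [abs_mul, abs_pow, abs_neg, abs_one, one_pow, one_mul]
    by_cases h1 : 2 * a s ≤ N
    · by_cases h2 : N < 2 * a s + n
      · rw [if_pos h1, if_pos ⟨h1, h2⟩, abs_mul, abs_pow]
        have h3 : |∑ B ∈ monics F (N - 2 * a s), symbol f B| ≤ (q : ℤ) ^ (N - 2 * a s) := by
          refine (Finset.abs_sum_le_sum_abs _ _).trans ?_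
          refine (Finset.sum_le_sum fun B _ => abs_symbol_le_one f B).trans ?_
          rw [Finset.sum_const, card_monics, nsmul_eq_mul, mul_one]
          push_cast
          rfl
        have h4 : |symbol f (∏ P ∈ s, P.1)| ^ 2 ≤ 1 :=
          pow_le_one₀ (abs_nonneg _) (abs_symbol_le_one _ _)
        calc _ ≤ 1 * (q : ℤ) ^ (N - 2 * a s) :=
              mul_le_mul h4 h3 (abs_nonneg _) zero_le_one
          _ = _ := one_mul _
      · rw [if_pos h1, if_neg (fun h => h2 h.2), sum_monics_symbol_eq_zero hF hf hns (by omega),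
          mul_zero, abs_zero]
    · rw [if_neg h1, if_neg (fun h => h1 h.1), abs_zero]
  have hmaps : ∀ s ∈ ((primeSet F N).powerset.filter
      fun s => 2 * a s ≤ N ∧ N < 2 * a s + n), a s ∈ (Finset.range (N + 1)).filter
      fun b => 2 * b ≤ N ∧ N < 2 * b + n := by
    intro s hs
    rw [Finset.mem_filter] at hs
    rw [Finset.mem_filter, Finset.mem_range]
    exact ⟨by omega, hs.2⟩
  rw [sum_ensemble_symbol f hf]
  calc |∑ s ∈ (primeSet F N).powerset, (-1 : ℤ) ^ s.card *
        if 2 * a s ≤ N then symbol f (∏ P ∈ s, P.1) ^ 2 *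
          ∑ B ∈ monics F (N - 2 * a s), symbol f B else 0|
      ≤ ∑ s ∈ (primeSet F N).powerset,
          if 2 * a s ≤ N ∧ N < 2 * a s + n then (q : ℤ) ^ (N - 2 * a s) else 0 :=
        (Finset.abs_sum_le_sum_abs _ _).trans (Finset.sum_le_sum fun s _ => hterm s)
    _ = ∑ b ∈ Finset.range (N + 1) with 2 * b ≤ N ∧ N < 2 * b + n,
          ∑ s ∈ ((primeSet F N).powerset.filter fun s => 2 * a s ≤ N ∧ N < 2 * a s + n)
            with a s = b, (q : ℤ) ^ (N - 2 * a s) := by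
        rw [← Finset.sum_filter, Finset.sum_fiberwise_of_maps_to hmaps]
    _ ≤ ∑ b ∈ Finset.range (N + 1) with 2 * b ≤ N ∧ N < 2 * b + n, (q : ℤ) ^ (N - b) := by
        refine Finset.sum_le_sum fun b hb => ?_
        rw [Finset.mem_filter] at hb
        set t := ((primeSet F N).powerset.filter fun s => 2 * a s ≤ N ∧ N < 2 * a s + n).filter
          fun s => a s = b with ht
        have h1 : ∀ s ∈ t, (q : ℤ) ^ (N - 2 * a s) = (q : ℤ) ^ (N - 2 * b) := fun s hs => by
          rw [(Finset.mem_filter.1 hs).2]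
        have h2 : t.card ≤ q ^ b := by
          rw [hq, ← card_monics]
          refine Finset.card_le_card_of_injOn (fun s => ∏ P ∈ s, P.1) (fun s hs => ?_)
            prod_primes_injective.injOn
          exact mem_monics.2 ⟨monic_prod s, (Finset.mem_filter.1 hs).2⟩
        rw [Finset.sum_congr rfl h1, Finset.sum_const, nsmul_eq_mul]
        have h3 : (t.card : ℤ) ≤ (q : ℤ) ^ b := by exact_mod_cast h2
        calc _ ≤ (q : ℤ) ^ b * (q : ℤ) ^ (N - 2 * b) :=
              mul_le_mul_of_nonneg_right h3 (by positivity)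
          _ = _ := by rw [← pow_add, show b + (N - 2 * b) = N - b by omega]
    _ ≤ ∑ k ∈ Finset.range ((N + n - 1) / 2 + 1), (q : ℤ) ^ k := by
        rw [← Finset.sum_image (f := fun k => (q : ℤ) ^ k) (g := fun b => N - b)]
        · refine Finset.sum_le_sum_of_subset_of_nonneg (fun k hk => ?_)
            fun k _ _ => by positivity
          rw [Finset.mem_image] at hk
          obtain ⟨b, hb, rfl⟩ := hk
          rw [Finset.mem_filter] at hb
          rw [Finset.mem_range]
          omega
        · intro b hb c hc hbc
          rw [Finset.mem_coe, Finset.mem_filter] at hb hc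
          simp only at hbc
          omega
    _ ≤ 2 * (q : ℤ) ^ ((N + n - 1) / 2) := by
        exact_mod_cast sum_range_pow_le hq2 _

/-! ### Averages of the coefficients of `L`-functions -/

open scoped Classical in
theorem sum_monics_squares {M : Type*} [AddCommMonoid M] (n : ℕ) (φ : F[X] → M) :
    ∑ f ∈ monics F n with ∃ l : F[X], l.Monic ∧ f = l ^ 2, φ f =
      if Even n then ∑ l ∈ monics F (n / 2), φ (l ^ 2) else 0 := by
  split_ifs with h
  · refine (Finset.sum_bij (fun l _ => l ^ 2) ?_ ?_ ?_ ?_).symm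
    · intro l hl
      obtain ⟨hm, hd⟩ := mem_monics.1 hl
      rw [Finset.mem_filter, mem_monics]
      refine ⟨⟨hm.pow 2, ?_⟩, l, hm, rfl⟩
      rw [hm.natDegree_pow, hd]
      exact Nat.mul_div_cancel' h.two_dvd
    · intro a ha b hb hab
      exact eq_of_sq_mul_squarefree_eq (mem_monics.1 ha).1 (mem_monics.1 hb).1 squarefree_one
        squarefree_one (by simpa using hab)
    · intro f hf
      rw [Finset.mem_filter, mem_monics] at hf
      obtain ⟨⟨hm, hd⟩, l, hl, rfl⟩ := hf
      rw [hl.natDegree_pow] at hd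
      exact ⟨l, mem_monics.2 ⟨hl, by omega⟩, rfl⟩
    · intros; rfl
  · apply Finset.sum_eq_zero
    intro f hf
    rw [Finset.mem_filter, mem_monics] at hf
    obtain ⟨⟨hm, hd⟩, l, hl, rfl⟩ := hf
    rw [hl.natDegree_pow] at hd
    exact absurd ⟨l.natDegree, by omega⟩ h

/-- The squares contribute the coprime pairs to the sum of the `n`-th coefficients of the
`L`-functions, and the other monic polynomials an error term. -/
theorem abs_sum_lCoeff_sub_le (hq : Fintype.card F ≡ 1 [MOD 4]) (n N : ℕ) :
    |∑ D ∈ ensemble F N, lCoeff D n - (if Even n then (coprimePairs F (n / 2) N : ℤ) else 0)| ≤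
      (Fintype.card F : ℤ) ^ n * (2 * (Fintype.card F : ℤ) ^ ((N + n - 1) / 2)) := by
  classical
  have h1 : ∑ D ∈ ensemble F N, lCoeff D n =
      ∑ f ∈ monics F n, ∑ D ∈ ensemble F N, symbol D f := by
    simp only [lCoeff]
    exact Finset.sum_comm
  have h2 : ∑ f ∈ monics F n with ∃ l : F[X], l.Monic ∧ f = l ^ 2,
      ∑ D ∈ ensemble F N, symbol D f =
      if Even n then (coprimePairs F (n / 2) N : ℤ) else 0 := by
    rw [sum_monics_squares]
    refine if_congr Iff.rfl ?_ rfl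
    rw [coprimePairs, Nat.cast_sum]
    refine Finset.sum_congr rfl fun l _ => ?_
    rw [Finset.card_filter, Nat.cast_sum]
    refine Finset.sum_congr rfl fun D hD => ?_
    rw [symbol_sq_right (mem_ensemble.1 hD).1]
    push_cast
    rfl
  rw [h1, ← Finset.sum_filter_add_sum_filter_not (monics F n)
    (fun f => ∃ l : F[X], l.Monic ∧ f = l ^ 2), h2, add_sub_cancel_left]
  refine (Finset.abs_sum_le_sum_abs _ _).trans ?_
  have h3 : ∀ f ∈ (monics F n).filter (fun f => ¬ ∃ l : F[X], l.Monic ∧ f = l ^ 2),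
      |∑ D ∈ ensemble F N, symbol D f| ≤ 2 * (Fintype.card F : ℤ) ^ ((N + n - 1) / 2) := by
    intro f hf
    rw [Finset.mem_filter, mem_monics] at hf
    obtain ⟨⟨hm, hd⟩, hns⟩ := hf
    push Not at hns
    have h4 : ∑ D ∈ ensemble F N, symbol D f = ∑ D ∈ ensemble F N, symbol f D :=
      Finset.sum_congr rfl fun D _ => symbol_comm hq D f
    rw [h4, ← hd]
    exact abs_sum_ensemble_symbol_le (ringChar_ne_two hq) hm hns N
  refine (Finset.sum_le_sum h3).trans ?_
  rw [Finset.sum_const, nsmul_eq_mul]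
  refine mul_le_mul_of_nonneg_right ?_ (by positivity)
  have := Finset.card_filter_le (monics F n) (fun f => ¬ ∃ l : F[X], l.Monic ∧ f = l ^ 2)
  rw [card_monics] at this
  exact_mod_cast this

/-! ### The central value -/

/-- The point `q ^ (-1/2)`. -/
def centralPoint (F : Type*) [Field F] [Fintype F] : ℝ := (Fintype.card F : ℝ) ^ (-(1 / 2) : ℝ)

theorem centralPoint_pos : 0 < centralPoint F :=
  Real.rpow_pos_of_pos (zero_lt_one.trans (one_lt_card_real F)) _

theorem centralPoint_sq_mul : centralPoint F ^ 2 * (Fintype.card F : ℝ) = 1 := by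
  have hq : (0 : ℝ) < Fintype.card F := zero_lt_one.trans (one_lt_card_real F)
  rw [centralPoint, ← Real.rpow_natCast, ← Real.rpow_mul hq.le]
  norm_num
  rw [Real.rpow_neg_one]
  exact inv_mul_cancel₀ hq.ne'

theorem centralPoint_le_one : centralPoint F ≤ 1 :=
  Real.rpow_le_one_of_one_le_of_nonpos (one_lt_card_real F).le (by norm_num)

theorem centralPoint_pow_mul_pow (m : ℕ) :
    centralPoint F ^ (2 * m) * (Fintype.card F : ℝ) ^ m = 1 := by
  rw [pow_mul, ← mul_pow, centralPoint_sq_mul, one_pow]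

/-- The average over the ensemble of the `n`-th term of the `L`-polynomial at the central point. -/
def averageTerm (F : Type*) [Field F] [Fintype F] (g n : ℕ) : ℝ :=
  ((∑ D ∈ ensemble F (2 * g + 1), lCoeff D n : ℤ) : ℝ) * centralPoint F ^ n /
    (ensemble F (2 * g + 1)).card

theorem centralAverage_eq_sum (hq : Fintype.card F ≡ 1 [MOD 4]) (g : ℕ) :
    centralAverage F g = ∑ n ∈ Finset.range (2 * g + 1), averageTerm F g n := by
  have h1 : ∀ D ∈ ensemble F (2 * g + 1), aeval ((Fintype.card F : ℝ) ^ (-(1 / 2) : ℝ))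
      (zetaNumerator D) = ∑ n ∈ Finset.range (2 * g + 1), (lCoeff D n : ℝ) * centralPoint F ^ n := by
    intro D hD
    obtain ⟨hm, hd, -⟩ := mem_ensemble.1 hD
    exact aeval_zetaNumerator hq hm hd _
  rw [centralAverage, Finset.sum_congr rfl h1, Finset.sum_comm, Finset.mul_sum]
  refine Finset.sum_congr rfl fun n _ => ?_
  rw [averageTerm, ← Finset.sum_mul, Int.cast_sum]
  ring

theorem averageTerm_symm (hq : Fintype.card F ≡ 1 [MOD 4]) {g n : ℕ} (hn : n ≤ 2 * g) :
    averageTerm F g (2 * g - n) = averageTerm F g n := by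
  have hq0 : (0 : ℝ) < Fintype.card F := zero_lt_one.trans (one_lt_card_real F)
  have hx := centralPoint_pos (F := F)
  have hfe : (Fintype.card F : ℝ) ^ g * ((∑ D ∈ ensemble F (2 * g + 1), lCoeff D n : ℤ) : ℝ) =
      (Fintype.card F : ℝ) ^ n *
        ((∑ D ∈ ensemble F (2 * g + 1), lCoeff D (2 * g - n) : ℤ) : ℝ) := by
    rw [Int.cast_sum, Int.cast_sum, Finset.mul_sum, Finset.mul_sum]
    refine Finset.sum_congr rfl fun D hD => ?_
    obtain ⟨hm, hd, hs⟩ := mem_ensemble.1 hD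
    exact_mod_cast lCoeff_functional_equation hq hm hs hd hn
  have h1 := centralPoint_pow_mul_pow (F := F) g
  have h2 := centralPoint_pow_mul_pow (F := F) n
  have h3 : centralPoint F ^ (2 * g) = centralPoint F ^ (2 * g - n) * centralPoint F ^ n := by
    rw [← pow_add, Nat.sub_add_cancel hn]
  rw [averageTerm, averageTerm]
  congr 1
  set T := ((∑ D ∈ ensemble F (2 * g + 1), lCoeff D n : ℤ) : ℝ)
  set T' := ((∑ D ∈ ensemble F (2 * g + 1), lCoeff D (2 * g - n) : ℤ) : ℝ)
  have hxn : centralPoint F ^ n ≠ 0 := (pow_pos hx n).ne'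
  apply mul_right_cancel₀ hxn
  rw [h3] at h1
  rw [two_mul, pow_add] at h2
  set x := centralPoint F ^ n
  set y := centralPoint F ^ (2 * g - n)
  set Q := (Fintype.card F : ℝ) ^ g
  set R := (Fintype.card F : ℝ) ^ n
  linear_combination (-(T' * y * x)) * h2 - x ^ 2 * y * x * hfe + x ^ 2 * T * h1

theorem sum_range_averageTerm (hq : Fintype.card F ≡ 1 [MOD 4]) (g : ℕ) :
    ∑ n ∈ Finset.range (2 * g + 1), averageTerm F g n =
      2 * ∑ n ∈ Finset.range g, averageTerm F g n + averageTerm F g g := by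
  have h1 : ∑ n ∈ Finset.range g, averageTerm F g (g + 1 + n) =
      ∑ n ∈ Finset.range g, averageTerm F g n := by
    rw [← Finset.sum_range_reflect]
    refine Finset.sum_congr rfl fun n hn => ?_
    rw [Finset.mem_range] at hn
    rw [← averageTerm_symm hq (n := n) (by omega)]
    congr 1
    omega
  rw [show 2 * g + 1 = (g + 1) + g by ring, Finset.sum_range_add, Finset.sum_range_succ, h1]
  ring

/-- The proportion of coprime pairs among the monic polynomials of degree `m` and the monic
square-free polynomials of degree `n`. -/
def coprimeProportion (F : Type*) [Field F] [Fintype F] (m n : ℕ) : ℝ :=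
  (coprimePairs F m n : ℝ) / ((Fintype.card F : ℝ) ^ m * (ensemble F n).card)

theorem coprimeProportion_nonneg (m n : ℕ) : 0 ≤ coprimeProportion F m n := by
  rw [coprimeProportion]
  positivity

theorem coprimeProportion_le_one (m n : ℕ) : coprimeProportion F m n ≤ 1 := by
  rw [coprimeProportion]
  refine div_le_one_of_le₀ ?_ (by positivity)
  exact_mod_cast coprimePairs_le m n

theorem abs_averageTerm_sub_le (hq : Fintype.card F ≡ 1 [MOD 4]) (g n : ℕ) :
    |averageTerm F g n - if Even n then coprimeProportion F (n / 2) (2 * g + 1) else 0| ≤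
      4 * (Fintype.card F : ℝ) ^ n / (Fintype.card F : ℝ) ^ g := by
  have hq1 := one_lt_card_real F
  have hq0 : (0 : ℝ) < Fintype.card F := zero_lt_one.trans hq1
  have hx := centralPoint_pos (F := F)
  set x := centralPoint F
  set q : ℝ := (Fintype.card F : ℝ) with hqdef
  set H : ℝ := ((ensemble F (2 * g + 1)).card : ℝ) with hH
  have hHle : q ^ (2 * g + 1) ≤ 2 * H := by
    rw [hqdef, hH]
    exact_mod_cast pow_le_two_mul_card_ensemble (F := F) (2 * g + 1)
  have hHpos : 0 < H := by
    have : 0 < q ^ (2 * g + 1) := by positivity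
    linarith
  have hT := abs_sum_lCoeff_sub_le hq n (2 * g + 1)
  have hT' : |((∑ D ∈ ensemble F (2 * g + 1), lCoeff D n : ℤ) : ℝ) -
      (if Even n then (coprimePairs F (n / 2) (2 * g + 1) : ℝ) else 0)| ≤
      q ^ n * (2 * q ^ (g + n / 2)) := by
    have h := (Int.cast_le (R := ℝ)).2 hT
    rw [show (2 * g + 1 + n - 1) / 2 = g + n / 2 by omega] at h
    push_cast at h
    rw [hqdef]
    push_cast
    exact h
  have hmain : (if Even n then coprimeProportion F (n / 2) (2 * g + 1) else 0) =
      (if Even n then (coprimePairs F (n / 2) (2 * g + 1) : ℝ) else 0) * x ^ n / H := by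
    split_ifs with h
    · obtain ⟨m, rfl⟩ := h
      have h1 := centralPoint_pow_mul_pow (F := F) m
      rw [show (m + m) / 2 = m by omega, coprimeProportion, ← two_mul]
      have hqm : (Fintype.card F : ℝ) ^ m ≠ 0 := by positivity
      rw [div_eq_div_iff (by positivity) (by positivity)]
      linear_combination -((coprimePairs F m (2 * g + 1) : ℝ) * H) * h1
    · rw [zero_mul, zero_div]
  have hxn : x ^ n * q ^ (n / 2) ≤ 1 := by
    have h1 := centralPoint_pow_mul_pow (F := F) (n / 2)
    have h2 : x ^ n ≤ x ^ (2 * (n / 2)) :=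
      pow_le_pow_of_le_one hx.le centralPoint_le_one (Nat.mul_div_le n 2)
    calc x ^ n * q ^ (n / 2) ≤ x ^ (2 * (n / 2)) * q ^ (n / 2) :=
          mul_le_mul_of_nonneg_right h2 (by positivity)
      _ = 1 := h1
  rw [hmain, averageTerm, ← sub_div, ← sub_mul, abs_div, abs_mul, abs_of_pos hHpos,
    abs_of_pos (pow_pos hx n), div_le_div_iff₀ hHpos (by positivity)]
  calc _ ≤ q ^ n * (2 * q ^ (g + n / 2)) * x ^ n * q ^ g := by gcongr
    _ = (x ^ n * q ^ (n / 2)) * (2 * q ^ n * q ^ (2 * g)) := by ring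
    _ ≤ 1 * (2 * q ^ n * q ^ (2 * g)) := mul_le_mul_of_nonneg_right hxn (by positivity)
    _ ≤ 2 * q ^ n * q ^ (2 * g + 1) := by
        rw [one_mul]
        exact mul_le_mul_of_nonneg_left (pow_le_pow_right₀ hq1.le (Nat.le_succ _)) (by positivity)
    _ ≤ 2 * q ^ n * (2 * H) := mul_le_mul_of_nonneg_left hHle (by positivity)
    _ = 4 * q ^ n * H := by ring

theorem sum_range_even (φ : ℕ → ℝ) (k : ℕ) :
    ∑ n ∈ Finset.range k, (if Even n then φ (n / 2) else 0) =
      ∑ m ∈ Finset.range ((k + 1) / 2), φ m := by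
  induction k with
  | zero => simp
  | succ k ih =>
    rw [Finset.sum_range_succ, ih]
    split_ifs with h
    · obtain ⟨m, rfl⟩ := h
      rw [show (m + m + 1 + 1) / 2 = m + 1 by omega, show (m + m + 1) / 2 = m by omega,
        show (m + m) / 2 = m by omega, Finset.sum_range_succ]
    · rw [Nat.not_even_iff_odd] at h
      obtain ⟨m, rfl⟩ := h
      rw [show (2 * m + 1 + 1 + 1) / 2 = m + 1 by omega, show (2 * m + 1 + 1) / 2 = m + 1 by omega,
        add_zero]

/-- The off-diagonal terms contribute a bounded amount to the average, since their sum over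
`n ≤ g` is dominated by its last term. -/
theorem abs_centralAverage_sub_le (hq : Fintype.card F ≡ 1 [MOD 4]) (g : ℕ) :
    |centralAverage F g -
      2 * ∑ m ∈ Finset.range ((g + 1) / 2), coprimeProportion F m (2 * g + 1)| ≤ 21 := by
  have hq0 : (0 : ℝ) < Fintype.card F := zero_lt_one.trans (one_lt_card_real F)
  set d : ℕ → ℝ := fun n => if Even n then coprimeProportion F (n / 2) (2 * g + 1) else 0 with hd
  have hgpos : (0 : ℝ) < (Fintype.card F : ℝ) ^ g := by positivity
  have h1 : ∑ n ∈ Finset.range g, |averageTerm F g n - d n| ≤ 8 := by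
    calc _ ≤ ∑ n ∈ Finset.range g, 4 * (Fintype.card F : ℝ) ^ n / (Fintype.card F : ℝ) ^ g :=
          Finset.sum_le_sum fun n _ => abs_averageTerm_sub_le hq g n
      _ = 4 * (∑ n ∈ Finset.range g, (Fintype.card F : ℝ) ^ n) / (Fintype.card F : ℝ) ^ g := by
          rw [Finset.mul_sum, Finset.sum_div]
      _ ≤ 8 := by
          rw [div_le_iff₀ hgpos]
          have h := sum_range_pow_le (q := Fintype.card F) Fintype.one_lt_card g
          have h' : ∑ n ∈ Finset.range (g + 1), (Fintype.card F : ℝ) ^ n ≤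
              2 * (Fintype.card F : ℝ) ^ g := by exact_mod_cast h
          rw [Finset.sum_range_succ] at h'
          linarith
  have h2 : |averageTerm F g g - d g| ≤ 4 := by
    refine (abs_averageTerm_sub_le hq g g).trans ?_
    rw [mul_div_assoc, div_self hgpos.ne', mul_one]
  have h3 : |d g| ≤ 1 := by
    simp only [hd]
    split_ifs
    · rw [abs_of_nonneg (coprimeProportion_nonneg _ _)]
      exact coprimeProportion_le_one _ _
    · simp
  have h4 : |∑ n ∈ Finset.range g, averageTerm F g n - ∑ n ∈ Finset.range g, d n| ≤ 8 := by
    rw [← Finset.sum_sub_distrib]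
    exact (Finset.abs_sum_le_sum_abs _ _).trans h1
  rw [centralAverage_eq_sum hq, sum_range_averageTerm hq,
    ← sum_range_even (fun m => coprimeProportion F m (2 * g + 1))]
  change |2 * ∑ n ∈ Finset.range g, averageTerm F g n + averageTerm F g g -
    2 * ∑ n ∈ Finset.range g, d n| ≤ 21
  rw [abs_le] at *
  constructor <;> linarith [h2.1, h2.2, h3.1, h3.2, h4.1, h4.2]

/-- Partial sums of a bounded double sequence with limit `P`, along a second index which tends to
infinity with the first. -/
theorem abs_sum_sub_le_of_tendsto {R : ℕ × ℕ → ℝ} {P : ℝ} (hR : Tendsto R atTop (nhds P))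
    (hR0 : ∀ p, |R p| ≤ 1) {ε : ℝ} (hε : 0 < ε) :
    ∃ B : ℝ, ∀ᶠ N in atTop, ∀ k : ℕ,
      |∑ m ∈ Finset.range k, R (m, N) - k * P| ≤ B + k * ε := by
  obtain ⟨⟨M₀, N₀⟩, h0⟩ := Metric.tendsto_atTop.1 hR ε hε
  refine ⟨M₀ * (1 + |P|), ?_⟩
  filter_upwards [eventually_ge_atTop N₀] with N hN k
  have h1 : ∀ m ∈ Finset.range k, |R (m, N) - P| ≤ (if m < M₀ then 1 + |P| else 0) + ε := by
    intro m _
    split_ifs with hm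
    · have := (abs_sub (R (m, N)) P).trans (add_le_add (hR0 _) le_rfl)
      linarith
    · rw [zero_add]
      exact (h0 (m, N) ⟨not_lt.1 hm, hN⟩).le
  have h2 : ∑ m ∈ Finset.range k, R (m, N) - k * P = ∑ m ∈ Finset.range k, (R (m, N) - P) := by
    rw [Finset.sum_sub_distrib, Finset.sum_const, Finset.card_range, nsmul_eq_mul]
  rw [h2]
  refine (Finset.abs_sum_le_sum_abs _ _).trans ((Finset.sum_le_sum h1).trans ?_)
  rw [Finset.sum_add_distrib, ← Finset.sum_filter, Finset.sum_const, Finset.sum_const,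
    Finset.card_range, nsmul_eq_mul, nsmul_eq_mul]
  have h3 : ((Finset.range k).filter (· < M₀)).card ≤ M₀ := by
    calc _ ≤ (Finset.range M₀).card := Finset.card_le_card fun m hm =>
            Finset.mem_range.2 (Finset.mem_filter.1 hm).2
      _ = M₀ := Finset.card_range _
  have h4 : (((Finset.range k).filter (· < M₀)).card : ℝ) ≤ M₀ := by exact_mod_cast h3
  have h5 : 0 ≤ 1 + |P| := by positivity
  nlinarith [mul_le_mul_of_nonneg_right h4 h5]

theorem centralAverage_isEquivalent (hq : Fintype.card F ≡ 1 [MOD 4]) :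
    centralAverage F ~[atTop] fun g : ℕ => 1 / 2 * arithFactor F 1 * (2 * (g : ℝ) + 1) := by
  set P := arithFactor F 1 with hP
  have hP0 : 0 < |P| := abs_pos.2 arithFactor_one_ne_zero
  rw [IsEquivalent, isLittleO_iff]
  intro c hc
  have hε : 0 < c * |P| / 2 := by positivity
  obtain ⟨B, hB⟩ := abs_sum_sub_le_of_tendsto (R := fun p => coprimeProportion F p.1 p.2)
    tendsto_coprimePairs (fun p => by
      rw [abs_of_nonneg (coprimeProportion_nonneg _ _)]
      exact coprimeProportion_le_one _ _) hε
  have hN : Tendsto (fun g : ℕ => 2 * g + 1) atTop atTop :=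
    tendsto_atTop_mono (fun g => show g ≤ 2 * g + 1 by omega) tendsto_id
  filter_upwards [hN.eventually hB, eventually_ge_atTop
    ⌈(21 + 2 * B + |P| + c * |P| / 2) / (c * |P| / 2)⌉₊] with g h1 h2
  have h3 := h1 ((g + 1) / 2)
  have h4 := abs_centralAverage_sub_le hq g
  have h5 := (div_le_iff₀ hε).1 (Nat.ceil_le.1 h2)
  set S := ∑ m ∈ Finset.range ((g + 1) / 2), coprimeProportion F m (2 * g + 1)
  set k : ℝ := (((g + 1) / 2 : ℕ) : ℝ) with hk
  have hk1 : (g : ℝ) ≤ 2 * k := by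
    have : g ≤ 2 * ((g + 1) / 2) := by omega
    rw [hk]
    exact_mod_cast this
  have hk2 : 2 * k ≤ (g : ℝ) + 1 := by
    have : 2 * ((g + 1) / 2) ≤ g + 1 := by omega
    rw [hk]
    exact_mod_cast this
  have h6 : |2 * k * P - (g + 1 / 2) * P| ≤ |P| := by
    rw [← sub_mul, abs_mul]
    have : |2 * k - ((g : ℝ) + 1 / 2)| ≤ 1 := by
      rw [abs_le]
      constructor <;> linarith
    nlinarith
  have h7 : |centralAverage F g - 1 / 2 * P * (2 * (g : ℝ) + 1)| ≤
      21 + 2 * (B + k * (c * |P| / 2)) + |P| := by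
    have e : centralAverage F g - 1 / 2 * P * (2 * (g : ℝ) + 1) =
        (centralAverage F g - 2 * S) + 2 * (S - k * P) + (2 * k * P - (g + 1 / 2) * P) := by ring
    rw [e]
    refine (abs_add_three _ _ _).trans ?_
    rw [abs_mul, abs_two]
    have h3' : |S - k * P| ≤ B + k * (c * |P| / 2) := h3
    linarith
  have h8 : ‖1 / 2 * P * (2 * (g : ℝ) + 1)‖ = |P| * ((g : ℝ) + 1 / 2) := by
    rw [Real.norm_eq_abs, show 1 / 2 * P * (2 * (g : ℝ) + 1) = P * ((g : ℝ) + 1 / 2) by ring,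
      abs_mul, abs_of_nonneg (by positivity : (0 : ℝ) ≤ (g : ℝ) + 1 / 2)]
  rw [h8, Pi.sub_apply, Real.norm_eq_abs]
  refine h7.trans ?_
  have h9 : 2 * k * (c * |P| / 2) ≤ (g + 1) * (c * |P| / 2) :=
    mul_le_mul_of_nonneg_right hk2 hε.le
  nlinarith

end HyperellipticMoment

end

/-- The first two clauses say that the objects in the asymptotic formula are the intended ones:
the truncation defining `P_{C_D}` loses nothing, so `Z_{C_D}(u) = P_{C_D}(u) / ((1 - u) (1 - q u))`,
and the product defining `P(1)` converges. -/
theorem mainTheorem2 (F : Type*) [Field F] [Fintype F] (hq : Fintype.card F ≡ 1 [MOD 4]) :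
    (∀ g : ℕ, ∀ D ∈ HyperellipticMoment.ensemble F (2 * g + 1),
      (1 - PowerSeries.X) * (1 - PowerSeries.C (Fintype.card F : ℚ) * PowerSeries.X) *
        HyperellipticMoment.zetaSeries D = (HyperellipticMoment.zetaNumerator D : PowerSeries ℚ)) ∧
    Multipliable (HyperellipticMoment.eulerFactor (F := F) 1) ∧
    (∀ g : ℕ, ∀ D ∈ HyperellipticMoment.ensemble F (2 * g + 1),
      1 / 2 * HyperellipticMoment.arithFactor F 1 *
          Real.logb (Fintype.card F) (HyperellipticMoment.polyNorm D) =
        1 / 2 * HyperellipticMoment.arithFactor F 1 * (2 * (g : ℝ) + 1)) ∧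
    HyperellipticMoment.centralAverage F ~[atTop]
      fun g : ℕ => 1 / 2 * HyperellipticMoment.arithFactor F 1 * (2 * (g : ℝ) + 1) := by
  refine ⟨fun g D hD => ?_, HyperellipticMoment.multipliable_eulerFactor, fun g D hD => ?_,
    HyperellipticMoment.centralAverage_isEquivalent hq⟩
  · obtain ⟨hm, hd, -⟩ := HyperellipticMoment.mem_ensemble.1 hD
    exact HyperellipticMoment.numeratorSeries_eq_zetaNumerator hq hm hd
  · obtain ⟨hm, hd, -⟩ := HyperellipticMoment.mem_ensemble.1 hD
    have h1 := HyperellipticMoment.one_lt_card_real F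
    rw [HyperellipticMoment.polyNorm_of_ne_zero hm.ne_zero, hd, Real.logb_pow,
      Real.logb_self_eq_one h1, mul_one]
    push_cast
    rfl
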